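/- Let $G$ be a finitely generated group with a fixed finite generating set and the associated word-length metric $d_G$ (so $G$ is discrete), let $\mathcal F$ be a family of subgroups of $G$, i.e. a set of subgroups closed under conjugation and under taking subgroups, and let $G$ act by homeomorphisms on a topological space $X$. Consider $G\times X$ with the diagonal action $g(h,x)=(gh,gx)$. An open $\mathcal F$-cover of $G\times X$ is a cover $\mathcal U$ by open sets such that $gU\in\mathcal U$ for all $g\in G$, $U\in\mathcal U$, and such that for each $U\in\mathcal U$ any two translates $gU,hU$ are equal or disjoint and the stabiliser $\{g\in G : gU=U\}$ belongs to $\mathcal F$. For $\alpha\in[0,\infty]$ let $B(g,\alpha)=\{h\in G : d_G(g,h)<\alpha\}$. We call $\mathcal U$ an $\alpha$-$\mathcal F$-eqasdim-covering if it is an open $\mathcal F$-cover, its dimension $\dim\,\mathcal U=\sup_{y\in G\times X}|\{U\in\mathcal U: y\in U\}|-1$ is finite, and $\alpha$ is a $G$-Lebesgue number of $\mathcal U$: for every $(g,x)\in G\times X$ there is $U\in\mathcal U$ with $B(g,\alpha)\times\{x\}\subseteq U$. **Proposition.** There is an $\mathcal F$-eqasdim-covering $\mathcal U_\infty$ of $G\times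 X$ with $\alpha=\infty$ (that is, an open $\mathcal F$-cover of finite dimension such that for every $x\in X$ and $g \in G$ some member contains $B(g,\infty)\times\{x\}=G\times\{x\}$) under any of the following conditions: (a) $X$ is a finite-dimensional simplicial complex (the geometric realisation of an abstract simplicial complex, with the weak topology or with the $\ell^1$-metric topology), $G$ acts simplicially, and the (setwise) stabilisers of the simplices belong to $\mathcal F$; (a') $X$ is a finite-dimensional $G$-CW-complex with cell stabilisers in $\mathcal F$, i.e. $X$ is a (Hausdorff) finite-dimensional CW-complex such that $G$ permutes the open $n$-cells for each $n$, every $g\in G$ that maps an open cell onto itself fixes it pointwise, and the stabilisers of the open cells belong to $\mathcal F$; (b) $X$ is regular (and $T_1$), the action is proper (every $x\in X$ has an open neighbourhood $U$ such that $\{g\in G : gU\cap U\neq\emptyset\}$ is finite), the isotropy groups $G_x$, $x\in X$, belong to $\mathcal F$, and either of the following holds: (i) the action is cocompact, i.e. $G\backslash X$ is compact; (ii) $X$ has finite covering dimension (for some $n$, every open cover of $X$ has an open refinement that covers $X$ and has dimension at most $n$), and the topology of $X$ is induced by a $G$-invariant metric. -/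

import Mathlib

open scoped Pointwise ENNReal

universe u v w

namespace EqAsdim

/-- A family of subgroups of `G`: a set of subgroups that is closed under conjugation and under
taking subgroups. -/
structure SubgroupFamily (G : Type*) [Group G] where
  carrier : Set (Subgroup G)
  conj_mem : ∀ H ∈ carrier, ∀ g : G, H.map (MulAut.conj g).toMonoidHom ∈ carrier
  subgroup_mem : ∀ H ∈ carrier, ∀ K : Subgroup G, K ≤ H → K ∈ carrier

section Covers

variable {G : Type*} [Group G] {Y : Type*}

/-- `U` is an `F`-subset of the `G`-set `Y`: its translates are pairwise equal or disjoint, and its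
stabiliser `{g | g U = U}` belongs to `F`. -/
def IsFSubset [MulAction G Y] (F : SubgroupFamily G) (U : Set Y) : Prop :=
  (∀ g h : G, g • U = h • U ∨ Disjoint (g • U) (h • U)) ∧
    MulAction.stabilizer G U ∈ F.carrier

/-- An `F`-cover of `Y`: a `G`-invariant cover that consists of `F`-subsets. -/
def IsFCover [MulAction G Y] (F : SubgroupFamily G) (𝒰 : Set (Set Y)) : Prop :=
  ⋃₀ 𝒰 = Set.univ ∧ (∀ U ∈ 𝒰, IsFSubset F U) ∧ (∀ g : G, ∀ U ∈ 𝒰, g • U ∈ 𝒰)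

/-- `dim 𝒰 ≤ n`: every point lies in at most `n + 1` members of the family `𝒰`. -/
def FamilyDimLE (𝒰 : Set (Set Y)) (n : ℕ) : Prop :=
  ∀ y : Y, {U | U ∈ 𝒰 ∧ y ∈ U}.encard ≤ (n : ℕ∞) + 1

/-- Word length of `g` with respect to `S`: the least length of a word in the letters `s`, `s⁻¹`
(`s ∈ S`) that represents `g` (it is `⊤` if there is none). -/
noncomputable def wordLength (S : Set G) (g : G) : ℕ∞ :=
  ⨅ (l : List G) (_ : (∀ x ∈ l, x ∈ S ∨ x⁻¹ ∈ S) ∧ l.prod = g), (l.length : ℕ∞)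

/-- The left-invariant word-length distance `d_G(g, h) = |g⁻¹ h|`. -/
noncomputable def wordDist (S : Set G) (g h : G) : ℝ≥0∞ :=
  ((wordLength S (g⁻¹ * h) : ℕ∞) : ℝ≥0∞)

/-- The ball `B(g, α)` in `G` for the word-length distance; `α = ∞` is allowed. -/
def wordBall (S : Set G) (g : G) (α : ℝ≥0∞) : Set G :=
  {h | wordDist S g h < α}

/-- `α` is a `G`-Lebesgue number of the family `𝒰` of subsets of `G × Y`. -/
def IsGLebesgueNumber (S : Set G) (α : ℝ≥0∞) (𝒰 : Set (Set (G × Y))) : Prop :=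
  ∀ (g : G) (y : Y), ∃ U ∈ 𝒰, wordBall S g α ×ˢ ({y} : Set Y) ⊆ U

/-- `𝒰` is an `α`-`F`-eqasdim-covering of `G × X`, where `G` acts diagonally: an open `F`-cover of
finite dimension with `G`-Lebesgue number `α`. -/
def IsEqasdimCovering [TopologicalSpace G] {X : Type*} [TopologicalSpace X] [MulAction G X]
    (F : SubgroupFamily G) (S : Set G) (α : ℝ≥0∞) (𝒰 : Set (Set (G × X))) : Prop :=
  (∀ U ∈ 𝒰, IsOpen U) ∧ IsFCover F 𝒰 ∧ (∃ n : ℕ, FamilyDimLE 𝒰 n) ∧ IsGLebesgueNumber S α 𝒰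

end Covers

section SimplicialComplexes

variable {V : Type*}

/-- The geometric realisation of an abstract simplicial complex with vertex set `V`, as a set:
the families of barycentric coordinates whose support is a simplex. -/
def Realization (K : AbstractSimplicialComplex V) : Type _ :=
  {x : V →₀ ℝ // x.support ∈ K ∧ (∀ v, 0 ≤ x v) ∧ x.sum (fun _ t => t) = 1}

/-- The closed simplex of the realisation that is spanned by `s`. -/
def closedSimplex (K : AbstractSimplicialComplex V) (s : Finset V) : Set (Realization K) :=
  {x | x.1.support ⊆ s}

/-- The Euclidean topology of a closed simplex, given by barycentric coordinates. -/
@[reducible]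
def closedSimplexTopology (K : AbstractSimplicialComplex V) (s : Finset V) :
    TopologicalSpace (closedSimplex K s) :=
  TopologicalSpace.induced (fun x (v : V) => x.1.1 v) Pi.topologicalSpace

/-- The weak topology of the realisation: a set is open if and only if its intersection with each
closed simplex is open in that simplex. -/
@[reducible]
def weakTopology (K : AbstractSimplicialComplex V) : TopologicalSpace (Realization K) :=
  ⨆ s : {s : Finset V // s ∈ K},
    TopologicalSpace.coinduced (Subtype.val : closedSimplex K s.1 → Realization K)
      (closedSimplexTopology K s.1)

/-- The realisation as a subset of `ℓ¹(V)`. -/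
noncomputable def toEllOne (K : AbstractSimplicialComplex V) (x : Realization K) :
    lp (fun _ : V => ℝ) 1 :=
  ⟨fun v => x.1 v, memℓp_gen (summable_of_hasFiniteSupport (by
    refine x.1.support.finite_toSet.subset fun v hv => ?_
    by_contra h
    simp only [Finset.mem_coe, Finsupp.mem_support_iff, not_not] at h
    simp [h] at hv))⟩

/-- The metric topology of the realisation, induced by the `ℓ¹`-distance of barycentric
coordinates. -/
@[reducible]
noncomputable def metricTopology (K : AbstractSimplicialComplex V) :
    TopologicalSpace (Realization K) :=
  TopologicalSpace.induced (toEllOne K) inferInstance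

end SimplicialComplexes

section Conditions

/-- `X` is a finite-dimensional simplicial complex (the realisation, with the weak or the metric
topology, of an abstract simplicial complex `K` with vertex set `V`), the group `G` acts
simplicially, and the stabilisers `{g | g s = s}` of the simplices `s` belong to `F`. The
identification `e` of `X` with the realisation carries the action of `G` on `X` to the action
that is induced by permuting the vertices. -/
def IsSimplicialAction.{v', u', w'} {G : Type u'} [Group G] (F : SubgroupFamily G) (X : Type w')
    [TopologicalSpace X] [MulAction G X] : Prop :=
  ∃ (V : Type v') (_ : MulAction G V) (K : AbstractSimplicialComplex V) (e : X ≃ Realization K),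
    (‹TopologicalSpace X› = TopologicalSpace.induced e (weakTopology K) ∨
      ‹TopologicalSpace X› = TopologicalSpace.induced e (metricTopology K)) ∧
    (∃ n : ℕ, ∀ s ∈ K, s.card ≤ n + 1) ∧
    (∀ g : G, ∀ s ∈ K, s.map (MulAction.toPerm g).toEmbedding ∈ K) ∧
    (∀ (g : G) (x : X) (v : V), (e (g • x)).1 (g • v) = (e x).1 v) ∧
    (∀ s ∈ K, MulAction.stabilizer G (s : Set V) ∈ F.carrier)

/-- `X` is a finite-dimensional `G`-CW-complex (for the discrete group `G`) with cell stabilisers in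
`F`: it has a CW-structure such that `G` permutes the open cells, an element that maps an
open cell to itself fixes it pointwise, and there are no cells of large dimension. -/
def IsGCWAction {G : Type*} [Group G] (F : SubgroupFamily G) (X : Type*) [TopologicalSpace X]
    [MulAction G X] : Prop :=
  T2Space X ∧ ∃ _ : Topology.CWComplex (Set.univ : Set X),
    (∃ N : ℕ, ∀ n, N < n → IsEmpty (Topology.CWComplex.cell (Set.univ : Set X) n)) ∧
    (∀ (g : G) (n : ℕ) (i : Topology.CWComplex.cell (Set.univ : Set X) n),
      ∃ j : Topology.CWComplex.cell (Set.univ : Set X) n,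
        g • Topology.CWComplex.openCell (C := (Set.univ : Set X)) n i =
          Topology.CWComplex.openCell (C := (Set.univ : Set X)) n j) ∧
    (∀ (g : G) (n : ℕ) (i : Topology.CWComplex.cell (Set.univ : Set X) n),
      g • Topology.CWComplex.openCell (C := (Set.univ : Set X)) n i =
          Topology.CWComplex.openCell (C := (Set.univ : Set X)) n i →
        ∀ x ∈ Topology.CWComplex.openCell (C := (Set.univ : Set X)) n i, g • x = x) ∧
    (∀ (n : ℕ) (i : Topology.CWComplex.cell (Set.univ : Set X) n),
      MulAction.stabilizer G (Topology.CWComplex.openCell (C := (Set.univ : Set X)) n i) ∈ F.carrier)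

/-- The action of the discrete group `G` on `X` is proper: every point has a neighbourhood that
meets only finitely many of its translates (counted by group elements). -/
def IsProperAction (G : Type*) [Group G] (X : Type*) [TopologicalSpace X] [MulAction G X] : Prop :=
  ∀ x : X, ∃ U : Set X, IsOpen U ∧ x ∈ U ∧ {g : G | ((g • U) ∩ U).Nonempty}.Finite

/-- The action is cocompact: the quotient space `G \ X` is compact. -/
def IsCocompactAction (G : Type*) [Group G] (X : Type*) [TopologicalSpace X] [MulAction G X] :
    Prop :=
  CompactSpace (Quotient (MulAction.orbitRel G X))

/-- The covering dimension of `X` is at most `n`: every open cover has an open refinement of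
dimension at most `n`. -/
def CoveringDimLE (X : Type*) [TopologicalSpace X] (n : ℕ) : Prop :=
  ∀ 𝒰 : Set (Set X), (∀ U ∈ 𝒰, IsOpen U) → ⋃₀ 𝒰 = Set.univ →
    ∃ 𝒱 : Set (Set X), (∀ V ∈ 𝒱, IsOpen V) ∧ ⋃₀ 𝒱 = Set.univ ∧
      (∀ V ∈ 𝒱, ∃ U ∈ 𝒰, V ⊆ U) ∧ FamilyDimLE 𝒱 n

/-- The topology of `X` is induced by a `G`-invariant metric. -/
def AdmitsInvariantMetric (G : Type*) [Group G] (X : Type*) [TopologicalSpace X]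
    [MulAction G X] : Prop :=
  ∃ m : MetricSpace X,
    m.toPseudoMetricSpace.toUniformSpace.toTopologicalSpace = ‹TopologicalSpace X› ∧
    ∀ (g : G) (x y : X), m.dist (g • x) (g • y) = m.dist x y

end Conditions

end EqAsdim

/-!
The members of the covering are the products `G × W`, where `W` runs through a `G`-invariant
finite-dimensional open cover of `X` by sets whose translates are equal or disjoint and whose
stabilisers belong to `F`; they contain `G × {x}` for each `x ∈ W`, so the Lebesgue number is `∞`.
The cover of `X` is organised by a colouring (`exists_isEqasdimCovering_of_coloring`): members of
one colour are equal or disjoint, the action preserves colours, and every point sees boundedly many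
colours.

For a simplicial complex, `W` runs through the open stars of the barycentres of the simplices in the
barycentric subdivision, coloured by the number of vertices. In barycentric coordinates the star of
`s` consists of the points whose coordinates on `s` are positive and larger than all others.

For a `G`-CW-complex, every open cell has a collar neighbourhood, coloured by the dimension of the
cell: a point belongs to it if repeated radial projection from the outer halves of the cells that it
passes through leads to the given cell. Collars of cells of equal dimension are disjoint because
the projection is a function; they are open because of the weak topology (`isOpen_cellCollar`); and
they are permuted by `G` once the characteristic maps are chosen equivariantly
(`exists_equivariant_characteristicMaps`).

For a proper action, every point has a slice (`IsProperAction.exists_isSlice`). In the cocompact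
case finitely many orbits of slices cover `X`. In the remaining case the slices have to be shrunk
so that only boundedly many orbits of them meet at a point, which is a statement about the dimension
of the orbit space `G \ X`, a pseudometric space. The orbit space is stratified by the order of the
isotropy group. On each stratum the projection restricts to an injection on slices, so `G \ X`
locally inherits the dimension of `X` there. Strata are countable unions of closed sets, and
Stone's construction turns local dimension bounds into bounds on countably many closed sets, so
`dim (G \ X) ≤ dim X` follows from the countable sum theorem
(`RelCoveringDimLE.univ_of_countable`).
-/

namespace EqAsdim

open scoped Topology

/-! ### From coloured covers of `X` to coverings of `G × X` -/

lemma smul_univ_prod {G X : Type*} [Group G] [MulAction G X] (g : G) (A : Set X) :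
    g • ((Set.univ : Set G) ×ˢ A) = (Set.univ : Set G) ×ˢ (g • A) := by
  ext ⟨h, x⟩
  simp [Set.mem_smul_set_iff_inv_smul_mem]

lemma univ_prod_injective {G X : Type*} [Group G] :
    Function.Injective fun A : Set X => (Set.univ : Set G) ×ˢ A := by
  intro A B h
  ext x
  simpa using Set.ext_iff.1 h (1, x)

/-- A `G`-invariant open cover `W` of `X` gives a covering of `G × X` with Lebesgue number `∞` that
consists of the sets `G × W i`. The colouring `c` encodes both requirements on the cover: members
of equal colour are equal or disjoint, so that they are `F`-subsets if the colouring is invariant,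
and a point lies in members of boundedly many colours. -/
theorem exists_isEqasdimCovering_of_coloring {G : Type*} [Group G] [TopologicalSpace G]
    (S : Set G) (F : SubgroupFamily G) {X : Type*} [TopologicalSpace X] [MulAction G X]
    {ι C : Type*} (W : ι → Set X) (c : ι → C) (hopen : ∀ i, IsOpen (W i))
    (hcover : ∀ x, ∃ i, x ∈ W i)
    (hdisj : ∀ i j, c i = c j → (W i ∩ W j).Nonempty → W i = W j)
    (hsmul : ∀ (g : G) i, ∃ j, c j = c i ∧ g • W i = W j)
    (hstab : ∀ i, (W i).Nonempty → MulAction.stabilizer G (W i) ∈ F.carrier)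
    {n : ℕ} (hdim : ∀ x, {k | ∃ i, c i = k ∧ x ∈ W i}.encard ≤ (n : ℕ∞) + 1) :
    ∃ U : Set (Set (G × X)), IsEqasdimCovering F S ⊤ U := by
  classical
  refine ⟨{U | ∃ i, (W i).Nonempty ∧ U = Set.univ ×ˢ W i}, ?_, ⟨?_, ?_, ?_⟩, ⟨n, ?_⟩, ?_⟩
  · rintro _ ⟨i, -, rfl⟩
    exact isOpen_univ.prod (hopen i)
  · refine Set.eq_univ_of_forall fun ⟨g, x⟩ => ?_
    obtain ⟨i, hi⟩ := hcover x
    exact ⟨_, ⟨i, ⟨x, hi⟩, rfl⟩, Set.mem_univ g, hi⟩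
  · rintro _ ⟨i, hi, rfl⟩
    refine ⟨fun g h => ?_, F.subgroup_mem _ (hstab i hi) _ fun g hg => ?_⟩
    · obtain ⟨j, hj, hgj⟩ := hsmul g i
      obtain ⟨k, hk, hhk⟩ := hsmul h i
      rw [smul_univ_prod, smul_univ_prod, hgj, hhk]
      by_cases hne : (W j ∩ W k).Nonempty
      · exact .inl (by rw [hdisj j k (hj.trans hk.symm) hne])
      · refine .inr (Set.disjoint_left.2 ?_)
        rintro ⟨a, x⟩ ⟨-, h1⟩ ⟨-, h2⟩
        exact hne ⟨x, h1, h2⟩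
    · rw [MulAction.mem_stabilizer_iff] at hg ⊢
      rw [smul_univ_prod] at hg
      exact univ_prod_injective hg
  · rintro g _ ⟨i, hi, rfl⟩
    obtain ⟨j, hj, hgj⟩ := hsmul g i
    exact ⟨j, hgj ▸ hi.smul_set, by rw [smul_univ_prod, hgj]⟩
  · rintro ⟨g, x⟩
    refine le_trans ?_ (hdim x)
    let f : C → Set (G × X) := fun k =>
      if h : ∃ i, c i = k ∧ x ∈ W i then Set.univ ×ˢ W h.choose else ∅
    refine le_trans (Set.encard_le_encard ?_) (Set.encard_image_le f _)
    rintro _ ⟨⟨i, hi, rfl⟩, -, hx⟩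
    have h : ∃ j, c j = c i ∧ x ∈ W j := ⟨i, rfl, hx⟩
    refine ⟨c i, h, ?_⟩
    simp only [f, dif_pos h]
    rw [hdisj _ i h.choose_spec.1 ⟨x, h.choose_spec.2, hx⟩]
  · intro g x
    obtain ⟨i, hi⟩ := hcover x
    refine ⟨_, ⟨i, ⟨x, hi⟩, rfl⟩, ?_⟩
    rintro ⟨a, y⟩ ⟨-, hy⟩
    obtain rfl : y = x := hy
    exact ⟨Set.mem_univ a, hi⟩

/-! ### Simplicial complexes -/

section Simplicial

variable {V : Type*}

/-- The open star of the barycentre of the simplex `s` in the barycentric subdivision: the points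
all of whose coordinates at vertices of `s` are positive and larger than those at the other
vertices. -/
def barycentricStar (K : AbstractSimplicialComplex V) (s : Finset V) : Set (Realization K) :=
  {x | ∀ v ∈ s, 0 < x.1 v ∧ ∀ w ∉ s, x.1 w < x.1 v}

lemma mem_barycentricStar_support {K : AbstractSimplicialComplex V} (x : Realization K) :
    x ∈ barycentricStar K x.1.support := by
  intro v hv
  have hpos : 0 < x.1 v := lt_of_le_of_ne (x.2.2.1 v) (Finsupp.mem_support_iff.1 hv).symm
  refine ⟨hpos, fun w hw => ?_⟩
  rwa [Finsupp.notMem_support_iff.1 hw]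

lemma subset_support_of_mem_barycentricStar {K : AbstractSimplicialComplex V} {s : Finset V}
    {x : Realization K} (hx : x ∈ barycentricStar K s) : s ⊆ x.1.support :=
  fun v hv => Finsupp.mem_support_iff.2 (hx v hv).1.ne'

/-- The simplices whose stars contain a given point form a chain. -/
lemma eq_of_mem_barycentricStar {K : AbstractSimplicialComplex V} {s t : Finset V}
    {x : Realization K} (hs : x ∈ barycentricStar K s) (ht : x ∈ barycentricStar K t)
    (hcard : s.card = t.card) : s = t := by
  by_cases h : s ⊆ t
  · exact Finset.eq_of_subset_of_card_le h hcard.ge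
  by_cases h' : t ⊆ s
  · exact (Finset.eq_of_subset_of_card_le h' hcard.le).symm
  obtain ⟨v, hv, hvt⟩ := Finset.not_subset.1 h
  obtain ⟨w, hw, hws⟩ := Finset.not_subset.1 h'
  exact absurd ((hs v hv).2 w hws) ((ht w hw).2 v hvt).le.not_gt

/-- Only the finitely many vertices of `t` matter on the closed simplex spanned by `t`. -/
lemma isOpen_barycentricStar_weakTopology (K : AbstractSimplicialComplex V) (s : Finset V) :
    IsOpen[weakTopology K] (barycentricStar K s) := by
  classical
  rw [isOpen_iSup_iff]
  rintro ⟨t, ht⟩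
  rw [isOpen_coinduced]
  let f : closedSimplex K t → V → ℝ := fun x v => x.1.1 v
  let _ : TopologicalSpace (closedSimplex K t) := closedSimplexTopology K t
  have hf : Continuous f := continuous_induced_dom
  have hfv : ∀ v, Continuous fun x : closedSimplex K t => x.1.1 v := fun v =>
    (continuous_apply v).comp hf
  have : Subtype.val ⁻¹' barycentricStar K s =
      ⋂ v ∈ s, ({x : closedSimplex K t | 0 < x.1.1 v} ∩
        ⋂ w ∈ t \ s, {x : closedSimplex K t | x.1.1 w < x.1.1 v}) := by
    ext x
    simp only [Set.mem_preimage, barycentricStar, Set.mem_ofPred_eq, Set.mem_iInter,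
      Set.mem_inter_iff, Finset.mem_sdiff]
    refine forall₂_congr fun v hv => and_congr_right fun hpos => ⟨fun h w hw => h w hw.2,
      fun h w hw => ?_⟩
    by_cases hwt : w ∈ t
    · exact h w ⟨hwt, hw⟩
    · have : x.1.1 w = 0 := Finsupp.notMem_support_iff.1 fun h => hwt (x.2 h)
      rwa [this]
  rw [this]
  exact isOpen_biInter_finset fun v _ => (isOpen_lt continuous_const (hfv v)).inter
    (isOpen_biInter_finset fun w _ => isOpen_lt (hfv w) (hfv v))

lemma isOpen_barycentricStar_metricTopology (K : AbstractSimplicialComplex V) (s : Finset V) :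
    IsOpen[metricTopology K] (barycentricStar K s) := by
  classical
  rcases s.eq_empty_or_nonempty with rfl | hne
  · have : barycentricStar K ∅ = Set.univ := Set.eq_univ_of_forall fun x v hv => by simp at hv
    rw [this]
    exact @isOpen_univ _ (metricTopology K)
  have hcoord : ∀ (f h : lp (fun _ : V => ℝ) 1) (v : V), |f v - h v| ≤ dist f h := fun f h v => by
    rw [dist_eq_norm]
    exact lp.norm_apply_le_norm one_ne_zero (f - h) v
  rw [isOpen_induced_iff]
  -- The gap `δ` between the coordinates inside and outside of `s` varies by at most twice
  -- the `ℓ¹`-distance.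
  refine ⟨⋃ (x : Realization K) (δ : ℝ) (_ : ∀ v ∈ s, δ < x.1 v ∧ ∀ w ∉ s, x.1 w + δ < x.1 v),
    Metric.ball (toEllOne K x) (δ / 2), ?_, ?_⟩
  · exact isOpen_iUnion fun x => isOpen_iUnion fun δ => isOpen_iUnion fun _ => Metric.isOpen_ball
  ext y
  simp only [Set.mem_preimage, Set.mem_iUnion, Metric.mem_ball, exists_prop]
  constructor
  · rintro ⟨x, δ, hδ, hy⟩ v hv
    have h0 := hcoord (toEllOne K y) (toEllOne K x)
    have hnn : 0 ≤ dist (toEllOne K y) (toEllOne K x) := dist_nonneg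
    have h1 : ∀ u, |y.1 u - x.1 u| < δ / 2 := fun u => (h0 u).trans_lt hy
    refine ⟨?_, fun w hw => ?_⟩
    · have := abs_lt.1 (h1 v)
      linarith [(hδ v hv).1]
    · have := abs_lt.1 (h1 v)
      have := abs_lt.1 (h1 w)
      linarith [(hδ v hv).2 w hw]
  · intro hy
    -- The values of `y` outside of `s` together with `0` have a maximum `M`.
    let T : Finset ℝ := insert 0 ((y.1.support \ s).image y.1)
    have hT : T.Nonempty := Finset.insert_nonempty _ _
    let I : Finset ℝ := s.image y.1
    have hI : I.Nonempty := hne.image _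
    let M := T.max' hT
    let m := I.min' hI
    have hm : ∀ v ∈ s, m ≤ y.1 v := fun v hv => Finset.min'_le _ _ (Finset.mem_image_of_mem _ hv)
    have hM0 : 0 ≤ M := Finset.le_max' _ _ (Finset.mem_insert_self _ _)
    have hM : ∀ w ∉ s, y.1 w ≤ M := fun w hw => by
      by_cases hws : w ∈ y.1.support
      · exact Finset.le_max' _ _ (Finset.mem_insert_of_mem
          (Finset.mem_image_of_mem _ (Finset.mem_sdiff.2 ⟨hws, hw⟩)))
      · rwa [Finsupp.notMem_support_iff.1 hws]
    have hMm : M < m := by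
      obtain ⟨v, hv, hvm⟩ := Finset.mem_image.1 (I.min'_mem hI)
      change M < I.min' hI
      rw [← hvm]
      rcases Finset.mem_insert.1 (T.max'_mem hT) with h | h
      · exact h.trans_lt (hy v hv).1
      · obtain ⟨w, hw, hwM⟩ := Finset.mem_image.1 h
        exact hwM.symm.trans_lt ((hy v hv).2 w (Finset.mem_sdiff.1 hw).2)
    refine ⟨y, (m - M) / 2, fun v hv => ⟨?_, fun w hw => ?_⟩, ?_⟩
    · linarith [hm v hv]
    · linarith [hm v hv, hM w hw]
    · rw [dist_self]
      linarith

lemma barycentricStar_nonempty (K : AbstractSimplicialComplex V) (s : Finset V) (hs : s ∈ K) :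
    (barycentricStar K s).Nonempty := by
  classical
  have hcard : 0 < (s.card : ℝ)⁻¹ := by
    have : 0 < s.card := (K.isRelLowerSet_faces hs).1.card_pos
    positivity
  let b : V →₀ ℝ := Finsupp.indicator s fun _ _ => (s.card : ℝ)⁻¹
  have hb : ∀ v ∈ s, b v = (s.card : ℝ)⁻¹ := fun v hv => Finsupp.indicator_of_mem hv _
  have hb' : ∀ v ∉ s, b v = 0 := fun v hv => Finsupp.indicator_of_notMem hv _
  have hsupp : b.support = s := by
    ext v
    rw [Finsupp.mem_support_iff]
    refine ⟨fun h => by_contra fun hv => h (hb' v hv), fun hv => ?_⟩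
    rw [hb v hv]
    exact hcard.ne'
  refine ⟨⟨b, hsupp.symm ▸ hs, fun v => ?_, ?_⟩, fun v hv => ⟨?_, fun w hw => ?_⟩⟩
  · by_cases hv : v ∈ s
    · exact (hb v hv).symm ▸ hcard.le
    · exact (hb' v hv).ge
  · rw [Finsupp.sum, hsupp, Finset.sum_congr rfl hb, Finset.sum_const, nsmul_eq_mul,
      mul_inv_cancel₀ (inv_pos.1 hcard).ne']
  · exact (hb v hv).symm ▸ hcard
  · change b w < b v
    rw [hb v hv, hb' w hw]
    exact hcard

end Simplicial

theorem exists_isEqasdimCovering_of_isSimplicialAction {G : Type u} [Group G]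
    [TopologicalSpace G] (S : Set G) (F : SubgroupFamily G) {X : Type w} [TopologicalSpace X]
    [MulAction G X] (hX : IsSimplicialAction.{v} F X) :
    ∃ U : Set (Set (G × X)), IsEqasdimCovering F S ⊤ U := by
  classical
  obtain ⟨V, _, K, e, htop, ⟨n, hn⟩, hK, he, hstab⟩ := hX
  let W : {s // s ∈ K} → Set X := fun s => e ⁻¹' barycentricStar K s.1
  let act : G → {s // s ∈ K} → {s // s ∈ K} := fun g s =>
    ⟨s.1.map (MulAction.toPerm g).toEmbedding, hK g s.1 s.2⟩
  have hact : ∀ (g : G) (s : {s // s ∈ K}) (v : V), g • v ∈ (act g s).1 ↔ v ∈ s.1 := by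
    intro g s v
    simp [act]
  have hmem : ∀ (g : G) (s : {s // s ∈ K}) (x : X), g • x ∈ W (act g s) ↔ x ∈ W s := by
    intro g s x
    have hsurj := MulAction.surjective (β := V) g
    constructor
    · intro h v hv
      have := h (g • v) ((hact g s v).2 hv)
      rw [he] at this
      refine ⟨this.1, fun w hw => ?_⟩
      have hgw := this.2 (g • w) (mt (hact g s w).1 hw)
      rwa [he] at hgw
    · intro h v' hv'
      obtain ⟨v, rfl⟩ := hsurj v'
      have := h v ((hact g s v).1 hv')
      rw [he]
      refine ⟨this.1, fun w' hw' => ?_⟩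
      obtain ⟨w, rfl⟩ := hsurj w'
      rw [he]
      exact this.2 w (mt (hact g s w).2 hw')
  have hsmul : ∀ (g : G) s, g • W s = W (act g s) := by
    intro g s
    ext x
    rw [Set.mem_smul_set_iff_inv_smul_mem, ← hmem g s, smul_inv_smul]
  have hne : ∀ s, (W s).Nonempty := fun s =>
    (barycentricStar_nonempty K s.1 s.2).preimage e.surjective
  have heq : ∀ s t : {s // s ∈ K}, s.1.card = t.1.card → (W s ∩ W t).Nonempty → s = t := by
    rintro s t hst ⟨x, hxs, hxt⟩
    exact Subtype.ext (eq_of_mem_barycentricStar hxs hxt hst)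
  refine exists_isEqasdimCovering_of_coloring S F W (fun s => s.1.card) (fun s => ?_)
    (fun x => ⟨⟨(e x).1.support, (e x).2.1⟩, mem_barycentricStar_support (e x)⟩)
    (fun s t hst hne => by rw [heq s t hst hne])
    (fun g s => ⟨act g s, Finset.card_map _, hsmul g s⟩) (fun s _ => ?_) (n := n) (fun x => ?_)
  · rcases htop with h | h
    · rw [h]
      exact ⟨_, isOpen_barycentricStar_weakTopology K s.1, rfl⟩
    · rw [h]
      exact ⟨_, isOpen_barycentricStar_metricTopology K s.1, rfl⟩
  · refine F.subgroup_mem _ (hstab s.1 s.2) _ fun g hg => ?_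
    rw [MulAction.mem_stabilizer_iff, hsmul] at hg
    have : act g s = s := heq _ _ (Finset.card_map _) (by rw [hg, Set.inter_self]; exact hne s)
    rw [MulAction.mem_stabilizer_iff]
    conv_rhs => rw [← this]
    simp [act, Set.image_smul]
  · -- The number of vertices of a nonempty simplex lies between `1` and `n + 1`.
    have hsub : {k | ∃ s : {s // s ∈ K}, s.1.card = k ∧ x ∈ W s} ⊆
        (Finset.Icc 1 (n + 1) : Set ℕ) := by
      rintro _ ⟨s, rfl, -⟩
      exact Finset.mem_coe.2 (Finset.mem_Icc.2
        ⟨(K.isRelLowerSet_faces s.2).1.card_pos, hn s.1 s.2⟩)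
    refine (Set.encard_le_encard hsub).trans ?_
    rw [Set.encard_coe_eq_coe_finsetCard]
    simp

/-! ### Slices of proper actions -/

/-- `U` is a slice at `x`, in the weak sense needed for discrete groups: `U` is an open
neighbourhood of `x` that is invariant under the isotropy group of `x` and disjoint from its other translates. -/
structure IsSlice (G : Type*) {X : Type*} [Group G] [TopologicalSpace X] [MulAction G X] (x : X)
    (U : Set X) : Prop where
  isOpen : IsOpen U
  mem : x ∈ U
  smul_eq : ∀ g ∈ MulAction.stabilizer G x, g • U = U
  mem_stabilizer : ∀ g : G, ((g • U) ∩ U).Nonempty → g ∈ MulAction.stabilizer G x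

section Slices

variable {G X : Type*} [Group G] [TopologicalSpace X] [MulAction G X]

lemma IsProperAction.finite_stabilizer (h : IsProperAction G X) (x : X) :
    Finite (MulAction.stabilizer G x) := by
  obtain ⟨U, -, hx, hfin⟩ := h x
  refine (hfin.subset fun g hg => ⟨x, ?_, hx⟩).to_subtype
  exact ⟨x, hx, hg⟩

lemma IsProperAction.exists_isSlice [ContinuousConstSMul G X] [T2Space X]
    (h : IsProperAction G X) (x : X) : ∃ U : Set X, IsSlice G x U := by
  obtain ⟨U, hU, hx, hfin⟩ := h x
  have := h.finite_stabilizer x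
  have hsep : ∀ g : G, g ∉ MulAction.stabilizer G x →
      ∃ N : Set X, IsOpen N ∧ x ∈ N ∧ Disjoint (g • N) N := by
    intro g hg
    obtain ⟨A, B, hA, hB, hxA, hxB, hAB⟩ := t2_separation (show g • x ≠ x from hg)
    refine ⟨(g⁻¹ • A) ∩ B, (hA.smul g⁻¹).inter hB, ⟨?_, hxB⟩, ?_⟩
    · rwa [Set.mem_smul_set_iff_inv_smul_mem, inv_inv]
    · rw [Set.smul_set_inter, smul_inv_smul]
      exact hAB.mono Set.inter_subset_left Set.inter_subset_right
  choose! N hN hxN hdisj using hsep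
  let T : Set G := {g | ((g • U) ∩ U).Nonempty} \ MulAction.stabilizer G x
  let U' : Set X := U ∩ ⋂ g ∈ T, N g
  have hU' : IsOpen U' :=
    hU.inter (hfin.sdiff.isOpen_biInter fun g hg => hN g hg.2)
  have hxU' : x ∈ U' := ⟨hx, Set.mem_iInter₂.2 fun g hg => hxN g hg.2⟩
  have hsub : (⋂ k : MulAction.stabilizer G x, k.1 • U') ⊆ U' := fun y hy => by
    simpa using Set.mem_iInter.1 hy 1
  refine ⟨⋂ k : MulAction.stabilizer G x, k.1 • U',
    isOpen_iInter_of_finite fun k => hU'.smul k.1, ?_, ?_, ?_⟩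
  · refine Set.mem_iInter.2 fun k => ⟨x, hxU', k.2⟩
  · intro g hg
    rw [Set.smul_set_iInter]
    refine (Equiv.mulLeft (⟨g, hg⟩ : MulAction.stabilizer G x)).surjective.iInf_congr _ fun k => ?_
    rw [smul_smul]
    rfl
  · intro g hg
    by_contra hgx
    obtain ⟨y, hy1, hy2⟩ := hg
    have hy1' : y ∈ g • U' := Set.smul_set_mono hsub hy1
    have hy2' : y ∈ U' := hsub hy2
    have hgT : g ∈ T :=
      ⟨⟨y, Set.smul_set_mono Set.inter_subset_left hy1', hy2'.1⟩, hgx⟩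
    have hUN : U' ⊆ N g := fun z hz => Set.mem_iInter₂.1 hz.2 g hgT
    exact Set.disjoint_left.1 (hdisj g hgx) (Set.smul_set_mono hUN hy1') (hUN hy2')

/-- Invariant subsets of slices whose saturations cover `X` with bounded multiplicity. -/
theorem exists_isEqasdimCovering_of_slices [ContinuousConstSMul G X] [TopologicalSpace G]
    (S : Set G) (F : SubgroupFamily G) (hF : ∀ x : X, MulAction.stabilizer G x ∈ F.carrier)
    {ι : Type*} (p : ι → X) (B : ι → Set X) (hopen : ∀ i, IsOpen (B i))
    (hB : ∀ i, ∀ g ∈ MulAction.stabilizer G (p i), g • B i = B i)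
    (hB' : ∀ i (g : G), ((g • B i) ∩ B i).Nonempty → g ∈ MulAction.stabilizer G (p i))
    (hcover : ∀ x, ∃ i, ∃ g : G, g • x ∈ B i)
    {n : ℕ} (hdim : ∀ x, {i | ∃ g : G, g • x ∈ B i}.encard ≤ (n : ℕ∞) + 1) :
    ∃ U : Set (Set (G × X)), IsEqasdimCovering F S ⊤ U := by
  refine exists_isEqasdimCovering_of_coloring S F (fun i : G × ι => i.1 • B i.2) Prod.snd
    (fun i => (hopen i.2).smul i.1) ?_ ?_ ?_ ?_ (n := n) ?_
  · intro x
    obtain ⟨i, g, hg⟩ := hcover x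
    exact ⟨(g⁻¹, i), by rwa [Set.mem_smul_set_iff_inv_smul_mem, inv_inv]⟩
  · rintro ⟨g, i⟩ ⟨h, j⟩ (rfl : i = j) hne
    have : (((h⁻¹ * g) • B i) ∩ B i).Nonempty := by
      obtain ⟨x, hx1, hx2⟩ := hne
      refine ⟨h⁻¹ • x, ?_, Set.mem_smul_set_iff_inv_smul_mem.1 hx2⟩
      rw [mul_smul]
      exact Set.smul_mem_smul_set hx1
    have := hB i _ (hB' i _ this)
    rw [mul_smul, inv_smul_eq_iff] at this
    exact this
  · rintro g ⟨h, i⟩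
    exact ⟨(g * h, i), rfl, (mul_smul g h (B i)).symm⟩
  · rintro ⟨g, i⟩ hne
    refine F.subgroup_mem _ (hF (g • p i)) _ fun h hh => ?_
    rw [MulAction.mem_stabilizer_iff] at hh
    have h1 : (g⁻¹ * h * g) • B i = B i := by
      rw [mul_smul, mul_smul, hh, inv_smul_smul]
    have h2 := hB' i (g⁻¹ * h * g) (by
      rw [h1, Set.inter_self]
      exact Set.smul_set_nonempty.1 hne)
    rw [MulAction.mem_stabilizer_iff, mul_smul, mul_smul, inv_smul_eq_iff] at h2
    exact h2
  · intro x
    refine le_trans (Set.encard_le_encard ?_) (hdim x)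
    rintro _ ⟨⟨g, i⟩, rfl, hx⟩
    exact ⟨g⁻¹, Set.mem_smul_set_iff_inv_smul_mem.1 hx⟩

theorem exists_isEqasdimCovering_of_isCocompactAction [ContinuousConstSMul G X] [T2Space X]
    [TopologicalSpace G] (S : Set G) (F : SubgroupFamily G)
    (hF : ∀ x : X, MulAction.stabilizer G x ∈ F.carrier) (hP : IsProperAction G X)
    (hC : IsCocompactAction G X) :
    ∃ U : Set (Set (G × X)), IsEqasdimCovering F S ⊤ U := by
  choose U hU using hP.exists_isSlice (G := G) (X := X)
  let π : X → Quotient (MulAction.orbitRel G X) := Quotient.mk _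
  have : CompactSpace (Quotient (MulAction.orbitRel G X)) := hC
  obtain ⟨t, ht⟩ := isCompact_univ.elim_finite_subcover (fun x => π '' U x)
    (fun x => isOpenMap_quotient_mk'_mul _ (hU x).isOpen)
    (fun y _ => by
      obtain ⟨x, rfl⟩ := Quotient.exists_rep y
      exact Set.mem_iUnion.2 ⟨x, x, (hU x).mem, rfl⟩)
  refine exists_isEqasdimCovering_of_slices S F hF (fun i : t => i.1) (fun i => U i.1)
    (fun i => (hU i.1).isOpen) (fun i => (hU i.1).smul_eq) (fun i => (hU i.1).mem_stabilizer)
    (fun x => ?_) (n := t.card) (fun x => ?_)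
  · obtain ⟨i, hi, y, hy, hyx⟩ := Set.mem_iUnion₂.1 (ht (Set.mem_univ (π x)))
    obtain ⟨g, hg⟩ := MulAction.orbitRel_apply.1 (Quotient.exact hyx)
    exact ⟨⟨i, hi⟩, g, (show g • x = y from hg) ▸ hy⟩
  · refine (Set.encard_le_encard (Set.subset_univ _)).trans ?_
    rw [Set.encard_univ, ENat.card_eq_coe_fintype_card, Fintype.card_coe]
    exact le_self_add

end Slices

/-! ### Covering dimension of subsets -/

/-- The covering dimension of the subset `A` of `Y` is at most `n`. The covers of `A` are indexed
families of open subsets of `Y`, refined with the same index set, and only the points of `A` matter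
for their multiplicity. -/
def RelCoveringDimLE {Y : Type w} [TopologicalSpace Y] (A : Set Y) (n : ℕ) : Prop :=
  ∀ (ι : Type w) (U : ι → Set Y), (∀ i, IsOpen (U i)) → A ⊆ ⋃ i, U i →
    ∃ V : ι → Set Y, (∀ i, IsOpen (V i)) ∧ (∀ i, V i ⊆ U i) ∧ A ⊆ ⋃ i, V i ∧
      ∀ y ∈ A, {i | y ∈ V i}.encard ≤ (n : ℕ∞) + 1

lemma CoveringDimLE.relCoveringDimLE {X : Type w} [TopologicalSpace X] {n : ℕ}
    (h : CoveringDimLE X n) {A : Set X} (hA : IsClosed A) : RelCoveringDimLE A n := by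
  classical
  intro ι U hU hAU
  cases isEmpty_or_nonempty ι
  · rw [Set.iUnion_of_empty] at hAU
    exact ⟨U, hU, fun _ => subset_rfl, hAU.trans (Set.empty_subset _), fun y hy => (hAU hy).elim⟩
  obtain ⟨𝒱, hopen, hcov, hsub, hdim⟩ := h (insert Aᶜ (Set.range U))
    (by
      rintro _ (rfl | ⟨i, rfl⟩)
      · exact hA.isOpen_compl
      · exact hU i)
    (Set.eq_univ_of_forall fun x => by
      by_cases hx : x ∈ A
      · obtain ⟨i, hi⟩ := Set.mem_iUnion.1 (hAU hx)
        exact ⟨U i, .inr ⟨i, rfl⟩, hi⟩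
      · exact ⟨Aᶜ, .inl rfl, hx⟩)
  -- Every member of the refinement that meets `A` is assigned to one member of the cover.
  have hex : ∀ V ∈ 𝒱, (V ∩ A).Nonempty → ∃ i, V ⊆ U i := by
    rintro V hV ⟨x, hxV, hxA⟩
    obtain ⟨_, rfl | ⟨i, rfl⟩, hVU⟩ := hsub V hV
    · exact absurd hxA (hVU hxV)
    · exact ⟨i, hVU⟩
  choose! f hf using hex
  refine ⟨fun i => ⋃₀ {V | V ∈ 𝒱 ∧ (V ∩ A).Nonempty ∧ f V = i},
    fun i => isOpen_sUnion fun V hV => hopen V hV.1, fun i => ?_, fun x hx => ?_, fun x hx => ?_⟩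
  · rintro x ⟨V, ⟨hV, hne, rfl⟩, hx⟩
    exact hf V hV hne hx
  · obtain ⟨V, hV, hxV⟩ := Set.mem_sUnion.1 (hcov ▸ Set.mem_univ x)
    exact Set.mem_iUnion.2 ⟨f V, V, ⟨hV, ⟨x, hxV, hx⟩, rfl⟩, hxV⟩
  · refine le_trans ?_ (hdim x)
    refine le_trans (Set.encard_le_encard ?_) (Set.encard_image_le f _)
    rintro _ ⟨V, ⟨hV, -, rfl⟩, hxV⟩
    exact ⟨V, ⟨hV, hxV⟩, rfl⟩

lemma RelCoveringDimLE.iUnion_of_locallyFinite {Y : Type w} [TopologicalSpace Y] {n : ℕ}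
    {κ : Type*} {B : κ → Set Y} (hB : ∀ k, RelCoveringDimLE (B k) n) (hclosed : ∀ k, IsClosed (B k))
    (hfin : LocallyFinite B) (hdisj : ∀ k l, k ≠ l → Disjoint (B k) (B l)) :
    RelCoveringDimLE (⋃ k, B k) n := by
  intro ι U hU hBU
  choose V hVopen hVU hcov hdim using fun k =>
    hB k ι U hU ((Set.subset_iUnion B k).trans hBU)
  have hR : ∀ k, IsClosed (⋃ l : {l // l ≠ k}, B l.1) := fun k =>
    (hfin.comp_injective Subtype.val_injective).isClosed_iUnion fun l => hclosed l.1
  refine ⟨fun i => ⋃ k, V k i \ ⋃ l : {l // l ≠ k}, B l.1,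
    fun i => isOpen_iUnion fun k => (hVopen k i).sdiff (hR k),
    fun i => Set.iUnion_subset fun k => Set.sdiff_subset.trans (hVU k i), fun y hy => ?_,
    fun y hy => ?_⟩
  · obtain ⟨k, hk⟩ := Set.mem_iUnion.1 hy
    obtain ⟨i, hi⟩ := Set.mem_iUnion.1 (hcov k hk)
    refine Set.mem_iUnion.2 ⟨i, Set.mem_iUnion.2 ⟨k, hi, fun h => ?_⟩⟩
    obtain ⟨l, hl⟩ := Set.mem_iUnion.1 h
    exact Set.disjoint_left.1 (hdisj l k l.2) hl hk
  · obtain ⟨k, hk⟩ := Set.mem_iUnion.1 hy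
    refine le_trans (Set.encard_le_encard fun i hi => ?_) (hdim k y hk)
    obtain ⟨l, hl, hl'⟩ := Set.mem_iUnion.1 hi
    by_cases h : k = l
    · exact h ▸ hl
    · exact absurd (Set.mem_iUnion.2 ⟨⟨k, h⟩, hk⟩) hl'

/-- Swelling of a locally finite closed family without increasing its multiplicity. -/
lemma exists_isOpen_swelling {Y ι : Type*} [PseudoMetricSpace Y] {n : ℕ} {F U : ι → Set Y}
    (hclosed : ∀ i, IsClosed (F i)) (hfin : LocallyFinite F) (hU : ∀ i, IsOpen (U i))
    (hFU : ∀ i, F i ⊆ U i) (hdim : ∀ y, {i | y ∈ F i}.encard ≤ (n : ℕ∞) + 1) :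
    ∃ V : ι → Set Y, (∀ i, IsOpen (V i)) ∧ (∀ i, F i ⊆ V i) ∧ (∀ i, V i ⊆ U i) ∧
      ∀ y, {i | y ∈ V i}.encard ≤ (n : ℕ∞) + 1 := by
  -- A ball around `x` of radius `2 * ε x` meets only those members that contain `x`.
  have hball : ∀ x : Y, ∃ ε > 0, ∀ z, dist z x < 2 * ε → ∀ i, z ∈ F i → x ∈ F i := by
    intro x
    have hN : IsClosed (⋃ i : {i // x ∉ F i}, F i) :=
      (hfin.comp_injective Subtype.val_injective).isClosed_iUnion fun i => hclosed i.1
    obtain ⟨ε, hε, hsub⟩ := Metric.isOpen_iff.1 hN.isOpen_compl x (by simp)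
    refine ⟨ε / 2, half_pos hε, fun z hz i hi => by_contra fun hx => ?_⟩
    exact hsub (Metric.mem_ball.2 (by linarith)) (Set.mem_iUnion.2 ⟨⟨i, hx⟩, hi⟩)
  choose ε hε hεF using hball
  refine ⟨fun i => U i ∩ ⋃ x ∈ F i, Metric.ball x (ε x),
    fun i => (hU i).inter (isOpen_biUnion fun x _ => Metric.isOpen_ball), fun i x hx =>
      ⟨hFU i hx, Set.mem_iUnion₂.2 ⟨x, hx, Metric.mem_ball_self (hε x)⟩⟩,
    fun i => Set.inter_subset_left, fun z => ?_⟩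
  by_contra hlt
  rw [not_le] at hlt
  obtain ⟨T, hT, hTcard⟩ := Set.exists_subset_encard_eq
    (show (n : ℕ∞) + 1 + 1 ≤ _ from Order.add_one_le_of_lt hlt)
  have hTfin : T.Finite := Set.finite_of_encard_eq_coe (k := n + 1 + 1) (by rw [hTcard]; rfl)
  have hTne : T.Nonempty := by
    rw [Set.nonempty_iff_ne_empty]
    rintro rfl
    rw [Set.encard_empty] at hTcard
    exact absurd hTcard (by exact_mod_cast (Nat.succ_ne_zero (n + 1)).symm)
  have : Nonempty Y := ⟨z⟩
  have hx : ∀ i ∈ T, ∃ x ∈ F i, dist z x < ε x := fun i hi => by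
    obtain ⟨x, hxF, hxz⟩ := Set.mem_iUnion₂.1 (hT hi).2
    exact ⟨x, hxF, hxz⟩
  choose! x hxF hxz using hx
  -- The centre of the largest of the balls lies in all members indexed by `T`.
  obtain ⟨j, hj, hmax⟩ := hTfin.exists_maximalFor (fun i => ε (x i)) T hTne
  have hmax' : ∀ i ∈ T, ε (x i) ≤ ε (x j) := fun i hi => by
    rcases le_total (ε (x i)) (ε (x j)) with h | h
    · exact h
    · exact hmax hi h
  have hsub : T ⊆ {i | x j ∈ F i} := fun i hi => by
    refine hεF (x j) (x i) ?_ i (hxF i hi)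
    have h1 := dist_triangle_left (x i) (x j) z
    linarith [hxz i hi, hxz j hj, hmax' i hi]
  have h1 := (Set.encard_le_encard hsub).trans (hdim (x j))
  rw [hTcard] at h1
  exact absurd h1 (not_le.2 (by exact_mod_cast Nat.lt_succ_self (n + 1)))

/-- One step in the proof of the sum theorem: a locally finite open cover can be shrunk so that the
closures of its members have multiplicity at most `n + 1` at the points of a closed set of
dimension at most `n`. -/
lemma RelCoveringDimLE.exists_shrinking {Y ι : Type w} [TopologicalSpace Y] [NormalSpace Y] {n : ℕ}
    {A : Set Y} (hA : RelCoveringDimLE A n) (hclosed : IsClosed A) {U : ι → Set Y}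
    (hU : ∀ i, IsOpen (U i)) (hfin : LocallyFinite U) (hcov : ⋃ i, U i = Set.univ) :
    ∃ V : ι → Set Y, (∀ i, IsOpen (V i)) ∧ (⋃ i, V i = Set.univ) ∧ (∀ i, closure (V i) ⊆ U i) ∧
      ∀ y ∈ A, {i | y ∈ closure (V i)}.encard ≤ (n : ℕ∞) + 1 := by
  obtain ⟨W, hW, hWU, hAW, hdim⟩ := hA ι U hU (hcov ▸ Set.subset_univ A)
  obtain ⟨V, hVcov, hV, hVsub⟩ := exists_iUnion_eq_closure_subset
    (u := fun i => W i ∪ (U i \ A)) (fun i => (hW i).union ((hU i).sdiff hclosed))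
    (fun x => (hfin.point_finite x).subset fun i hi =>
      Set.union_subset (hWU i) Set.sdiff_subset hi)
    (Set.eq_univ_of_forall fun x => by
      by_cases hx : x ∈ A
      · obtain ⟨i, hi⟩ := Set.mem_iUnion.1 (hAW hx)
        exact Set.mem_iUnion.2 ⟨i, .inl hi⟩
      · obtain ⟨i, hi⟩ := Set.mem_iUnion.1 (hcov ▸ Set.mem_univ x : x ∈ ⋃ i, U i)
        exact Set.mem_iUnion.2 ⟨i, .inr ⟨hi, hx⟩⟩)
  refine ⟨V, hV, hVcov, fun i => (hVsub i).trans (Set.union_subset (hWU i) Set.sdiff_subset),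
    fun y hy => le_trans (Set.encard_le_encard fun i hi => ?_) (hdim y hy)⟩
  exact (hVsub i hi).resolve_right fun h => h.2 hy

/-- The countable sum theorem of dimension theory. -/
theorem RelCoveringDimLE.univ_of_countable {Y : Type w} [PseudoMetricSpace Y] {n : ℕ}
    {κ : Type*} [Countable κ] [Nonempty κ] {A : κ → Set Y} (hA : ∀ k, RelCoveringDimLE (A k) n)
    (hclosed : ∀ k, IsClosed (A k)) (hcov : ⋃ k, A k = Set.univ) :
    RelCoveringDimLE (Set.univ : Set Y) n := by
  intro ι U hU hUcov
  obtain ⟨e, he⟩ := exists_surjective_nat κ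
  obtain ⟨U₀, hU₀, hU₀cov, hU₀fin, hU₀U⟩ := precise_refinement U hU (Set.univ_subset_iff.1 hUcov)
  have hstep : ∀ (k : ℕ) (U : ι → Set Y), ((∀ i, IsOpen (U i)) ∧ LocallyFinite U ∧
      ⋃ i, U i = Set.univ) → ∃ V : ι → Set Y, (∀ i, IsOpen (V i)) ∧ (⋃ i, V i = Set.univ) ∧
      (∀ i, closure (V i) ⊆ U i) ∧
      ∀ y ∈ A (e k), {i | y ∈ closure (V i)}.encard ≤ (n : ℕ∞) + 1 := fun k U hU =>
    (hA (e k)).exists_shrinking (hclosed (e k)) hU.1 hU.2.1 hU.2.2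
  choose! next hopen hnextcov hnextsub hnextdim using hstep
  let s : ℕ → ι → Set Y := fun k => Nat.rec U₀ next k
  have hs : ∀ k, (∀ i, IsOpen (s k i)) ∧ LocallyFinite (s k) ∧ ⋃ i, s k i = Set.univ := by
    intro k
    induction k with
    | zero => exact ⟨hU₀, hU₀fin, hU₀cov⟩
    | succ k ih =>
      exact ⟨hopen k _ ih, ih.2.1.subset fun i => subset_closure.trans (hnextsub k _ ih i),
        hnextcov k _ ih⟩
  have hsub : ∀ k i, closure (s (k + 1) i) ⊆ s k i := fun k => hnextsub k _ (hs k)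
  have hanti : ∀ i, Antitone fun k => s k i := fun i =>
    antitone_nat_of_succ_le fun k => subset_closure.trans (hsub k i)
  let F : ι → Set Y := fun i => ⋂ k, closure (s (k + 1) i)
  have hFU₀ : ∀ i, F i ⊆ U₀ i := fun i => (Set.iInter_subset _ 0).trans (hsub 0 i)
  have hFclosed : ∀ i, IsClosed (F i) := fun i => isClosed_iInter fun k => isClosed_closure
  -- A point lies in finitely many members of `U₀`, so one of them contains it at every stage.
  have hFcov : ∀ y, ∃ i, y ∈ F i := by
    intro y
    by_contra! hy
    have hy' : ∀ i, ∃ k, y ∉ closure (s (k + 1) i) := fun i => by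
      simpa only [F, Set.mem_iInter, not_forall] using hy i
    choose k hk using hy'
    obtain ⟨K, hK⟩ := ((hU₀fin.point_finite y).image k).bddAbove
    obtain ⟨i, hi⟩ := Set.mem_iUnion.1 ((hs (K + 1)).2.2 ▸ Set.mem_univ y : y ∈ ⋃ i, s (K + 1) i)
    have hiK : k i ≤ K := hK ⟨i, hanti i (Nat.zero_le (K + 1)) hi, rfl⟩
    exact hk i (subset_closure (hanti i (Nat.succ_le_succ hiK) hi))
  obtain ⟨V, hV, hFV, hVU, hdim⟩ := exists_isOpen_swelling (n := n) hFclosed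
    (hU₀fin.subset hFU₀) hU₀ hFU₀ (fun y => by
      obtain ⟨k, hk⟩ := Set.mem_iUnion.1 (hcov ▸ Set.mem_univ y : y ∈ ⋃ k, A k)
      obtain ⟨m, rfl⟩ := he k
      exact (Set.encard_le_encard fun i hi => Set.mem_iInter.1 (show y ∈ F i from hi) m).trans
        (hnextdim m _ (hs m) y hk))
  refine ⟨V, hV, fun i => (hVU i).trans (hU₀U i), fun y _ => ?_, fun y _ => hdim y⟩
  obtain ⟨i, hi⟩ := hFcov y
  exact Set.mem_iUnion.2 ⟨i, hFV i hi⟩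

/-- Stone's construction: the members of an open cover, with those that come earlier in a
well-order removed, contain closed sets which for each `p` are at distance at least `1 / (p + 1)`
from each other, and which for varying `p` still cover. -/
lemma exists_discrete_closed_refinement {Y Λ : Type*} [PseudoEMetricSpace Y] (W : Λ → Set Y)
    (hW : ∀ l, IsOpen (W l)) :
    ∃ E : ℕ → Λ → Set Y, (∀ p l, IsClosed (E p l)) ∧ (∀ p l, E p l ⊆ W l) ∧
      (∀ p, LocallyFinite (E p)) ∧ (∀ p l m, l ≠ m → Disjoint (E p l) (E p m)) ∧
      ⋃ l, W l ⊆ ⋃ p, ⋃ l, E p l := by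
  classical
  let _ : LinearOrder Λ := linearOrderOfSTO WellOrderingRel
  have hwf : WellFounded ((· < ·) : Λ → Λ → Prop) := WellOrderingRel.isWellOrder.wf
  let ε : ℕ → ℝ≥0∞ := fun p => ((p : ℝ≥0∞) + 1)⁻¹
  have hε : ∀ p, 0 < ε p := fun p => ENNReal.inv_pos.2 (by finiteness)
  let E : ℕ → Λ → Set Y := fun p l => {y | ε p ≤ Metric.infEDist y (W l)ᶜ} \ ⋃ m < l, W m
  have hEW : ∀ p l, E p l ⊆ W l := fun p l y hy => by
    by_contra h
    have h0 : Metric.infEDist y (W l)ᶜ = 0 := Metric.infEDist_zero_of_mem h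
    exact (hε p).not_ge (h0 ▸ hy.1)
  have hlt : ∀ p l m, l < m → ∀ y ∈ E p l, ∀ z ∈ E p m, ε p ≤ edist y z := by
    intro p l m hlm y hy z hz
    exact hy.1.trans (Metric.infEDist_le_edist_of_mem (Set.mem_compl fun h =>
      hz.2 (Set.mem_iUnion₂.2 ⟨l, hlm, h⟩)))
  have hsep : ∀ p l m, l ≠ m → ∀ y ∈ E p l, ∀ z ∈ E p m, ε p ≤ edist y z := by
    intro p l m hlm y hy z hz
    rcases lt_or_gt_of_ne hlm with h | h
    · exact hlt p l m h y hy z hz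
    · exact edist_comm z y ▸ hlt p m l h z hz y hy
  refine ⟨E, fun p l => ?_, hEW, fun p y => ?_, fun p l m hlm => ?_, fun y hy => ?_⟩
  · refine IsClosed.sdiff ?_ (isOpen_biUnion fun m _ => hW m)
    exact isClosed_le continuous_const Metric.continuous_infEDist
  · refine ⟨Metric.eball y (ε p / 2), Metric.eball_mem_nhds y (ENNReal.half_pos (hε p).ne'),
      Set.Subsingleton.finite ?_⟩
    rintro l ⟨a, ha, hay⟩ m ⟨b, hb, hby⟩
    by_contra hlm
    refine (hsep p l m hlm a ha b hb).not_gt ?_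
    calc edist a b ≤ edist a y + edist b y := edist_triangle_right a b y
      _ < ε p / 2 + ε p / 2 := ENNReal.add_lt_add hay hby
      _ = ε p := ENNReal.add_halves _
  · refine Set.disjoint_left.2 fun y hy hy' => (hε p).not_ge ?_
    exact (hsep p l m hlm y hy y hy').trans (edist_self y).le
  · obtain ⟨l₀, hl₀⟩ := Set.mem_iUnion.1 hy
    obtain ⟨l, hl, hmin⟩ := hwf.has_min {l | y ∈ W l} ⟨l₀, hl₀⟩
    have hpos : 0 < Metric.infEDist y (W l)ᶜ := by
      rw [Metric.infEDist_pos_iff_notMem_closure, (hW l).isClosed_compl.closure_eq]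
      exact fun h => h hl
    obtain ⟨p, hp⟩ := ENNReal.exists_inv_nat_lt hpos.ne'
    refine Set.mem_iUnion₂.2 ⟨p, l, ?_, fun h => ?_⟩
    · exact (ENNReal.inv_le_inv.2 le_self_add).trans hp.le
    · obtain ⟨m, hm, hym⟩ := Set.mem_iUnion₂.1 h
      exact hmin m hym hm

/-- A closed set that locally has dimension at most `n` is a countable union of closed sets of
dimension at most `n`. -/
lemma exists_iUnion_eq_of_locally_relCoveringDimLE {Y : Type w} [PseudoEMetricSpace Y] {n : ℕ}
    {A : Set Y} (hA : IsClosed A)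
    (h : ∀ y ∈ A, ∃ W, IsOpen W ∧ y ∈ W ∧ ∀ B, IsClosed B → B ⊆ A → B ⊆ W → RelCoveringDimLE B n) :
    ∃ P : ℕ → Set Y, (∀ p, IsClosed (P p)) ∧ (∀ p, RelCoveringDimLE (P p) n) ∧ ⋃ p, P p = A := by
  choose W hW hyW hdim using fun y : A => h y y.2
  obtain ⟨E, hE, hEW, hfin, hdisj, hcov⟩ := exists_discrete_closed_refinement W hW
  have hfin' : ∀ p, LocallyFinite fun l => A ∩ E p l := fun p =>
    (hfin p).subset fun l => Set.inter_subset_right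
  refine ⟨fun p => ⋃ l, A ∩ E p l,
    fun p => (hfin' p).isClosed_iUnion fun l => hA.inter (hE p l), fun p => ?_, ?_⟩
  · exact RelCoveringDimLE.iUnion_of_locallyFinite (fun l => hdim l _ (hA.inter (hE p l))
      Set.inter_subset_left (Set.inter_subset_right.trans (hEW p l))) (fun l => hA.inter (hE p l)) (hfin' p)
      fun l m hlm => (hdisj p l m hlm).mono Set.inter_subset_right Set.inter_subset_right
  · refine Set.Subset.antisymm (Set.iUnion_subset fun p => Set.iUnion_subset fun l =>
      Set.inter_subset_left) fun y hy => ?_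
    obtain ⟨p, hp⟩ := Set.mem_iUnion.1 (hcov (Set.mem_iUnion.2 ⟨⟨y, hy⟩, hyW ⟨y, hy⟩⟩))
    obtain ⟨l, hl⟩ := Set.mem_iUnion.1 hp
    exact Set.mem_iUnion₂.2 ⟨p, l, hy, hl⟩

/-! ### The orbit space of an isometric action -/

/-- The orbit space `G \ X`, to be equipped with the pseudometric
`dist (G x) (G y) = ⨅ g, dist x (g y)` instead of the quotient topology. -/
def OrbitSpace (G : Type*) (X : Type*) [Group G] [MulAction G X] : Type _ :=
  Quotient (MulAction.orbitRel G X)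

namespace OrbitSpace

variable {G X : Type*} [Group G] [MulAction G X]

/-- The orbit of a point. -/
def mk (x : X) : OrbitSpace G X := Quotient.mk _ x

lemma mk_surjective : Function.Surjective (mk : X → OrbitSpace G X) := Quotient.mk_surjective

lemma mk_eq_mk {x y : X} : (mk x : OrbitSpace G X) = mk y ↔ ∃ g : G, g • y = x :=
  Quotient.eq.trans MulAction.orbitRel_apply

@[simp] lemma mk_smul (g : G) (x : X) : (mk (g • x) : OrbitSpace G X) = mk x :=
  mk_eq_mk.2 ⟨g, rfl⟩

variable [PseudoMetricSpace X]

lemma bddBelow_range_dist (x y : X) : BddBelow (Set.range fun g : G => dist x (g • y)) :=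
  ⟨0, by rintro _ ⟨g, rfl⟩; exact dist_nonneg⟩

variable [IsIsometricSMul G X]

lemma iInf_dist_smul_smul (a b : G) (x y : X) :
    ⨅ g : G, dist (a • x) (g • b • y) = ⨅ g : G, dist x (g • y) := by
  refine ((Equiv.mulLeft a⁻¹).trans (Equiv.mulRight b)).iInf_congr fun g => ?_
  rw [← dist_smul a x, smul_smul, smul_smul]
  simp [mul_assoc]

noncomputable instance : PseudoMetricSpace (OrbitSpace G X) where
  dist := Quotient.lift₂ (fun x y => ⨅ g : G, dist x (g • y)) (by
    rintro _ _ x y ⟨a, rfl⟩ ⟨b, rfl⟩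
    exact iInf_dist_smul_smul a b x y)
  dist_self y := by
    obtain ⟨x, rfl⟩ := mk_surjective y
    refine le_antisymm ?_ (Real.iInf_nonneg fun g => dist_nonneg)
    exact (ciInf_le (bddBelow_range_dist x x) (1 : G)).trans (by simp)
  dist_comm y z := by
    obtain ⟨x, rfl⟩ := mk_surjective y
    obtain ⟨x', rfl⟩ := mk_surjective z
    refine (Equiv.inv G).iInf_congr fun g => ?_
    rw [Equiv.inv_apply, ← dist_smul g, smul_inv_smul, dist_comm]
  dist_triangle y z w := by
    obtain ⟨x, rfl⟩ := mk_surjective y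
    obtain ⟨x', rfl⟩ := mk_surjective z
    obtain ⟨x'', rfl⟩ := mk_surjective w
    refine le_ciInf_add_ciInf fun g h => (ciInf_le (bddBelow_range_dist x x'') (g * h)).trans ?_
    rw [← dist_smul g x', mul_smul]
    exact dist_triangle _ _ _

lemma dist_mk_lt_iff {x y : X} {r : ℝ} :
    dist (mk x : OrbitSpace G X) (mk y) < r ↔ ∃ g : G, dist x (g • y) < r :=
  ⟨exists_lt_of_ciInf_lt, fun ⟨g, hg⟩ => (ciInf_le (bddBelow_range_dist x y) g).trans_lt hg⟩

lemma continuous_mk : Continuous (mk : X → OrbitSpace G X) := by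
  refine (LipschitzWith.of_dist_le_mul (K := 1) fun x y => ?_).continuous
  refine (ciInf_le (bddBelow_range_dist x y) (1 : G)).trans ?_
  simp

lemma isOpenMap_mk : IsOpenMap (mk : X → OrbitSpace G X) := by
  intro U hU
  rw [Metric.isOpen_iff]
  rintro _ ⟨x, hx, rfl⟩
  obtain ⟨r, hr, hsub⟩ := Metric.isOpen_iff.1 hU x hx
  refine ⟨r, hr, fun z hz => ?_⟩
  obtain ⟨y, rfl⟩ := mk_surjective z
  obtain ⟨g, hg⟩ := dist_mk_lt_iff.1 (Metric.mem_ball'.1 hz)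
  exact ⟨g • y, hsub (Metric.mem_ball'.2 hg), mk_smul g y⟩

end OrbitSpace

/-! ### The dimension of the orbit space of a proper isometric action -/

lemma card_stabilizer_smul {G X : Type*} [Group G] [MulAction G X] (g : G) (x : X) :
    Nat.card (MulAction.stabilizer G (g • x)) = Nat.card (MulAction.stabilizer G x) :=
  Nat.card_congr (MulAction.stabilizerEquivStabilizerOfOrbitRel
    (MulAction.orbitRel_apply.2 ⟨g, rfl⟩)).toEquiv

lemma IsSlice.stabilizer_le {G X : Type*} [Group G] [TopologicalSpace X] [MulAction G X] {x y : X}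
    {U : Set X} (hU : IsSlice G x U) (hy : y ∈ U) :
    MulAction.stabilizer G y ≤ MulAction.stabilizer G x :=
  fun g hg => hU.mem_stabilizer g ⟨y, ⟨y, hy, hg⟩, hy⟩

/-- The orbits of points whose isotropy group has order at most `k`. (Infinite isotropy groups
count as order `0`, but do not occur for proper actions.) -/
def isotropyStratum (G : Type u) (X : Type w) [Group G] [MulAction G X] (k : ℕ) :
    Set (OrbitSpace G X) :=
  OrbitSpace.mk '' {x : X | Nat.card (MulAction.stabilizer G x) ≤ k}

lemma mk_mem_isotropyStratum {G : Type u} {X : Type w} [Group G] [MulAction G X] {k : ℕ} {x : X} :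
    OrbitSpace.mk x ∈ isotropyStratum G X k ↔ Nat.card (MulAction.stabilizer G x) ≤ k := by
  refine ⟨?_, fun h => ⟨x, h, rfl⟩⟩
  rintro ⟨y, hy, hyx⟩
  obtain ⟨g, rfl⟩ := OrbitSpace.mk_eq_mk.1 hyx
  exact (card_stabilizer_smul g x).ge.trans hy

section

variable {G : Type u} {X : Type w} [Group G] [MetricSpace X] [MulAction G X] [IsIsometricSMul G X]

lemma IsProperAction.isOpen_isotropyStratum (hP : IsProperAction G X) (k : ℕ) :
    IsOpen (isotropyStratum G X k) := by
  refine OrbitSpace.isOpenMap_mk _ (isOpen_iff_mem_nhds.2 fun x hx => ?_)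
  obtain ⟨U, hU⟩ := hP.exists_isSlice (G := G) x
  have := hP.finite_stabilizer x
  exact Filter.mem_of_superset (hU.isOpen.mem_nhds hU.mem) fun y hy =>
    (Nat.card_le_card_of_injective _ (Subgroup.inclusion_injective (hU.stabilizer_le hy))).trans hx

/-- On the set of points with isotropy groups of fixed order, the projection to the orbit space is
injective on slices, so that closed subsets of the orbit space locally inherit the dimension of
`X` there. -/
lemma IsProperAction.locally_relCoveringDimLE (hP : IsProperAction G X) {n : ℕ}
    (hn : CoveringDimLE X n) {k : ℕ} {A : Set (OrbitSpace G X)}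
    (hA : ∀ x : X, OrbitSpace.mk x ∈ A → Nat.card (MulAction.stabilizer G x) = k)
    (y : OrbitSpace G X) (hy : y ∈ A) :
    ∃ W, IsOpen W ∧ y ∈ W ∧ ∀ B, IsClosed B → B ⊆ A → B ⊆ W → RelCoveringDimLE B n := by
  obtain ⟨x, rfl⟩ := OrbitSpace.mk_surjective y
  obtain ⟨U, hU⟩ := hP.exists_isSlice (G := G) x
  have hfin := hP.finite_stabilizer x
  obtain ⟨r, hr, hrU⟩ := Metric.isOpen_iff.1 hU.isOpen x hU.mem
  refine ⟨Metric.ball (OrbitSpace.mk x) r, Metric.isOpen_ball, Metric.mem_ball_self hr,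
    fun B hB hBA hBW ι O hO hBO => ?_⟩
  have hrep : ∀ b ∈ B, ∃ z ∈ Metric.ball x r, OrbitSpace.mk z = b := by
    intro b hb
    obtain ⟨z, rfl⟩ := OrbitSpace.mk_surjective b
    obtain ⟨g, hg⟩ := OrbitSpace.dist_mk_lt_iff.1 (Metric.mem_ball'.1 (hBW hb))
    exact ⟨g • z, Metric.mem_ball'.2 hg, OrbitSpace.mk_smul g z⟩
  have huniq : ∀ z ∈ Metric.ball x r, ∀ z' ∈ Metric.ball x r,
      (OrbitSpace.mk z : OrbitSpace G X) ∈ B →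
      (OrbitSpace.mk z' : OrbitSpace G X) = OrbitSpace.mk z → z' = z := by
    intro z hz z' hz' hzB hzz'
    obtain ⟨g, rfl⟩ := OrbitSpace.mk_eq_mk.1 hzz'
    have hg : g ∈ MulAction.stabilizer G x :=
      hU.mem_stabilizer g ⟨g • z, ⟨z, hrU hz, rfl⟩, hrU hz'⟩
    have hst : MulAction.stabilizer G z = MulAction.stabilizer G x :=
      Subgroup.eq_of_le_of_card_ge (hU.stabilizer_le (hrU hz))
        (by rw [hA x hy, hA z (hBA hzB)])
    rw [← hst] at hg
    exact hg
  obtain ⟨V, hV, hVO, hCV, hdim⟩ := hn.relCoveringDimLE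
    ((hB.preimage OrbitSpace.continuous_mk).inter (Metric.isClosed_closedBall (x := x) (ε := r)))
    ι (fun i => OrbitSpace.mk ⁻¹' O i) (fun i => (hO i).preimage OrbitSpace.continuous_mk)
    (fun z hz => by
      obtain ⟨i, hi⟩ := Set.mem_iUnion.1 (hBO hz.1)
      exact Set.mem_iUnion.2 ⟨i, hi⟩)
  refine ⟨fun i => OrbitSpace.mk '' (V i ∩ Metric.ball x r),
    fun i => OrbitSpace.isOpenMap_mk _ ((hV i).inter Metric.isOpen_ball), ?_, fun b hb => ?_,
    fun b hb => ?_⟩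
  · rintro i _ ⟨z, hz, rfl⟩
    exact hVO i hz.1
  · obtain ⟨z, hz, rfl⟩ := hrep b hb
    obtain ⟨i, hi⟩ := Set.mem_iUnion.1 (hCV ⟨hb, Metric.ball_subset_closedBall hz⟩)
    exact Set.mem_iUnion.2 ⟨i, z, ⟨hi, hz⟩, rfl⟩
  · obtain ⟨z, hz, rfl⟩ := hrep b hb
    refine (Set.encard_le_encard ?_).trans (hdim z ⟨hb, Metric.ball_subset_closedBall hz⟩)
    rintro i ⟨z', ⟨hi, hz'⟩, hzz'⟩
    exact huniq z hz z' hz' hb hzz' ▸ hi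

/-- The dimension does not increase under passage to the orbit space of a proper isometric
action. -/
theorem IsProperAction.relCoveringDimLE_orbitSpace (hP : IsProperAction G X) {n : ℕ}
    (hn : CoveringDimLE X n) : RelCoveringDimLE (Set.univ : Set (OrbitSpace G X)) n := by
  have hopen := hP.isOpen_isotropyStratum
  -- The stratum of isotropy order `k + 1` is the union of the closed sets `E k m \ stratum k`.
  choose E hE hEsub hEunion _ using fun k => (hopen (k + 1)).exists_iUnion_isClosed
  have hA : ∀ k m, ∃ P : ℕ → Set (OrbitSpace G X), (∀ p, IsClosed (P p)) ∧
      (∀ p, RelCoveringDimLE (P p) n) ∧ ⋃ p, P p = E k m \ isotropyStratum G X k := fun k m =>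
    exists_iUnion_eq_of_locally_relCoveringDimLE ((hE k m).sdiff (hopen k))
      (hP.locally_relCoveringDimLE hn (k := k + 1) fun x hx =>
        le_antisymm (mk_mem_isotropyStratum.1 (hEsub k m hx.1))
          (not_le.1 fun h => hx.2 (mk_mem_isotropyStratum.2 h)))
  choose P hPclosed hPdim hPunion using hA
  refine RelCoveringDimLE.univ_of_countable (κ := ℕ × ℕ × ℕ) (A := fun i => P i.1 i.2.1 i.2.2)
    (fun i => hPdim _ _ _) (fun i => hPclosed _ _ _) (Set.eq_univ_of_forall fun y => ?_)
  obtain ⟨x, rfl⟩ := OrbitSpace.mk_surjective y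
  have := hP.finite_stabilizer x
  obtain ⟨k, hk⟩ := Nat.exists_eq_succ_of_ne_zero
    (Nat.card_pos (α := MulAction.stabilizer G x)).ne'
  have h1 : (OrbitSpace.mk x : OrbitSpace G X) ∈ ⋃ m, E k m :=
    hEunion k ▸ mk_mem_isotropyStratum.2 hk.le
  obtain ⟨m, hm⟩ := Set.mem_iUnion.1 h1
  have h2 : (OrbitSpace.mk x : OrbitSpace G X) ∈ ⋃ p, P k m p := by
    rw [hPunion]
    exact ⟨hm, fun h => (Nat.lt_succ_self k).not_ge (hk ▸ mk_mem_isotropyStratum.1 h)⟩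
  obtain ⟨p, hp⟩ := Set.mem_iUnion.1 h2
  exact Set.mem_iUnion.2 ⟨(k, m, p), hp⟩

theorem exists_isEqasdimCovering_of_coveringDimLE [TopologicalSpace G] (S : Set G)
    (F : SubgroupFamily G) (hF : ∀ x : X, MulAction.stabilizer G x ∈ F.carrier)
    (hP : IsProperAction G X) {n : ℕ} (hn : CoveringDimLE X n) :
    ∃ U : Set (Set (G × X)), IsEqasdimCovering F S ⊤ U := by
  choose U hU using hP.exists_isSlice (G := G) (X := X)
  obtain ⟨V, hV, hVU, hcov, hdim⟩ := hP.relCoveringDimLE_orbitSpace hn X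
    (fun x => OrbitSpace.mk '' U x) (fun x => OrbitSpace.isOpenMap_mk _ (hU x).isOpen)
    (fun y _ => by
      obtain ⟨x, rfl⟩ := OrbitSpace.mk_surjective y
      exact Set.mem_iUnion.2 ⟨x, x, (hU x).mem, rfl⟩)
  refine exists_isEqasdimCovering_of_slices S F hF id
    (fun x => U x ∩ OrbitSpace.mk ⁻¹' V x)
    (fun x => (hU x).isOpen.inter ((hV x).preimage OrbitSpace.continuous_mk))
    (fun x g hg => ?_) (fun x g hg => (hU x).mem_stabilizer g (hg.mono ?_))
    (fun z => ?_) (n := n) (fun z => ?_)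
  · rw [Set.smul_set_inter, (hU x).smul_eq g hg]
    congr 1
    ext z
    rw [Set.mem_smul_set_iff_inv_smul_mem, Set.mem_preimage, Set.mem_preimage,
      OrbitSpace.mk_smul]
  · exact Set.inter_subset_inter (Set.smul_set_mono Set.inter_subset_left) Set.inter_subset_left
  · obtain ⟨x, hx⟩ := Set.mem_iUnion.1 (hcov (Set.mem_univ (OrbitSpace.mk z)))
    obtain ⟨y, hy, hyz⟩ := hVU x hx
    obtain ⟨g, rfl⟩ := OrbitSpace.mk_eq_mk.1 hyz
    exact ⟨x, g, hy, by rwa [Set.mem_preimage, OrbitSpace.mk_smul]⟩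
  · refine (Set.encard_le_encard ?_).trans (hdim (OrbitSpace.mk z) (Set.mem_univ _))
    rintro x ⟨g, -, hg⟩
    rwa [Set.mem_preimage, OrbitSpace.mk_smul] at hg

end

open Topology (CWComplex RelCWComplex)
open Topology.RelCWComplex (cell openCell closedCell)

/-! ### `G`-CW-complexes -/

section CW

variable {G : Type u} [Group G] {X : Type w} [TopologicalSpace X] [MulAction G X]

/-- Characteristic maps that are compatible with the action. The cells in one orbit get the
translates of the characteristic map of one of them, which is unambiguous because an element that
preserves an open cell fixes it pointwise. -/
lemma exists_equivariant_characteristicMaps [ContinuousConstSMul G X] [T2Space X]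
    [CWComplex (Set.univ : Set X)]
    (hperm : ∀ (g : G) (n : ℕ) (i : cell (Set.univ : Set X) n),
      ∃ j : cell (Set.univ : Set X) n,
        g • openCell (C := (Set.univ : Set X)) n i =
          openCell (C := (Set.univ : Set X)) n j)
    (hfix : ∀ (g : G) (n : ℕ) (i : cell (Set.univ : Set X) n),
      g • openCell (C := (Set.univ : Set X)) n i =
          openCell (C := (Set.univ : Set X)) n i →
        ∀ x ∈ openCell (C := (Set.univ : Set X)) n i, g • x = x) :
    ∃ ψ : ∀ n : ℕ, cell (Set.univ : Set X) n → (Fin n → ℝ) → X,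
      (∀ n i, ContinuousOn (ψ n i) (Metric.closedBall 0 1)) ∧
      (∀ n i, Set.InjOn (ψ n i) (Metric.ball 0 1)) ∧
      (∀ n i, ψ n i '' Metric.ball 0 1 = openCell (C := (Set.univ : Set X)) n i) ∧
      (∀ n i, ψ n i '' Metric.closedBall 0 1 =
        closedCell (C := (Set.univ : Set X)) n i) ∧
      (∀ n i, ∃ I : ∀ m, Set (cell (Set.univ : Set X) m), (∀ m, (I m).Finite) ∧
        Set.MapsTo (ψ n i) (Metric.sphere 0 1) (⋃ (m < n) (j ∈ I m),
          closedCell (C := (Set.univ : Set X)) m j)) ∧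
      (∀ (g : G) n i j, g • openCell (C := (Set.univ : Set X)) n i =
          openCell (C := (Set.univ : Set X)) n j →
        ∀ y ∈ Metric.closedBall 0 1, ψ n j y = g • ψ n i y) := by
  have hclosure : ∀ n i, closure (openCell (C := (Set.univ : Set X)) n i) =
      closedCell (C := (Set.univ : Set X)) n i := fun n i =>
    RelCWComplex.closure_openCell_eq_closedCell
  have hclosed : ∀ (g : G) (n : ℕ) (i j : cell (Set.univ : Set X) n),
      g • openCell (C := (Set.univ : Set X)) n i =
        openCell (C := (Set.univ : Set X)) n j →
      g • closedCell (C := (Set.univ : Set X)) n i =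
        closedCell (C := (Set.univ : Set X)) n j := by
    intro g n i j h
    rw [← hclosure, ← hclosure, ← h, closure_smul]
  have hfix' : ∀ (g : G) (n : ℕ) (i : cell (Set.univ : Set X) n),
      g • openCell (C := (Set.univ : Set X)) n i =
          openCell (C := (Set.univ : Set X)) n i →
        ∀ x ∈ closedCell (C := (Set.univ : Set X)) n i, g • x = x := by
    intro g n i h x hx
    rw [← hclosure] at hx
    exact closure_minimal (hfix g n i h) (isClosed_eq (continuous_const_smul g) continuous_id) hx
  let r : ∀ n, Setoid (cell (Set.univ : Set X) n) := fun n =>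
    { r := fun i j => ∃ g : G, g • openCell (C := (Set.univ : Set X)) n i =
          openCell (C := (Set.univ : Set X)) n j
      iseqv := ⟨fun i => ⟨1, one_smul _ _⟩, fun ⟨g, hg⟩ => ⟨g⁻¹, by rw [← hg, inv_smul_smul]⟩,
        fun ⟨g, hg⟩ ⟨h, hh⟩ => ⟨h * g, by rw [mul_smul, hg, hh]⟩⟩ }
  let rep : ∀ n, cell (Set.univ : Set X) n → cell (Set.univ : Set X) n :=
    fun n i => (Quotient.mk (r n) i).out
  have hrep : ∀ n i, ∃ g : G, g • openCell (C := (Set.univ : Set X)) n (rep n i) =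
      openCell (C := (Set.univ : Set X)) n i := fun n i =>
    Quotient.exact (s := r n) (Quotient.out_eq _)
  choose a ha using hrep
  refine ⟨fun n i y => a n i • RelCWComplex.map (C := (Set.univ : Set X)) n (rep n i) y,
    fun n i => (CWComplex.continuousOn n (rep n i)).const_smul _, fun n i => ?_, fun n i => ?_,
    fun n i => ?_, fun n i => ?_, ?_⟩
  · refine (MulAction.injective (a n i)).comp_injOn ?_
    rw [← CWComplex.source_eq (C := (Set.univ : Set X)) n (rep n i)]
    exact (RelCWComplex.map (C := (Set.univ : Set X)) n (rep n i)).injOn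
  · rw [← ha n i, ← Set.image_smul, openCell, Set.image_image]
  · rw [← hclosed _ n _ _ (ha n i), ← Set.image_smul, closedCell, Set.image_image]
  · obtain ⟨I, hI⟩ := CWComplex.mapsTo (C := (Set.univ : Set X)) n (rep n i)
    choose f hf using fun m => hperm (a n i) m
    refine ⟨fun m => f m '' (I m : Set _), fun m => (I m).finite_toSet.image _, fun y hy => ?_⟩
    obtain ⟨m, hm, j, hj, hx⟩ := by simpa only [Set.mem_iUnion, exists_prop] using hI hy
    simp only [Set.mem_iUnion, exists_prop]
    refine ⟨m, hm, f m j, Set.mem_image_of_mem _ hj, ?_⟩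
    rw [← hclosed _ m _ _ (hf m j)]
    exact Set.smul_mem_smul_set hx
  · intro g n i j hij y hy
    have hr : rep n i = rep n j :=
      congrArg Quotient.out (Quotient.sound (s := r n) ⟨g, hij⟩)
    have hst : ((a n j)⁻¹ * (g * a n i)) •
        openCell (C := (Set.univ : Set X)) n (rep n i) =
          openCell (C := (Set.univ : Set X)) n (rep n i) := by
      rw [mul_smul, mul_smul, ha, hij, ← ha n j, inv_smul_smul, hr]
    have := hfix' _ n _ hst _ ⟨y, hy, rfl⟩
    rw [mul_smul, mul_smul, inv_smul_eq_iff] at this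
    change a n j • RelCWComplex.map (C := (Set.univ : Set X)) n (rep n j) y = _
    rw [← hr]
    exact this.symm

/-- The collar neighbourhood of the open cell `e n i`, where `e m j` is parametrised by the open
unit ball via `ψ m j`. It contains `e n i`, and a point of a cell of larger dimension that lies
outside of the ball of radius `1 / 2` belongs to it if its radial projection to the boundary of
the cell does. -/
inductive CellCollar {X : Type w} {κ : ℕ → Type w} (ψ : ∀ n, κ n → (Fin n → ℝ) → X)
    (n : ℕ) (i : κ n) : X → Prop
  | base (y : Fin n → ℝ) (hy : ‖y‖ < 1) : CellCollar ψ n i (ψ n i y)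
  | step (m : ℕ) (j : κ m) (y : Fin m → ℝ) (hm : n < m) (hy : 1 / 2 < ‖y‖) (hy' : ‖y‖ < 1)
      (h : CellCollar ψ n i (ψ m j (‖y‖⁻¹ • y))) : CellCollar ψ n i (ψ m j y)

section Collar

variable {X : Type w} {κ : ℕ → Type w} {ψ : ∀ n, κ n → (Fin n → ℝ) → X}

/-- A point of a collar lies either in the cell itself or in the outer part of a cell of larger
dimension. -/
lemma cellCollar_iff_of_mem
    (hinj : ∀ n i, Set.InjOn (ψ n i) (Metric.ball 0 1))
    (hdisj : ∀ n i m j, ∀ y ∈ Metric.ball 0 1, ∀ z ∈ Metric.ball 0 1, ψ n i y = ψ m j z →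
      (⟨n, i⟩ : Σ n, κ n) = ⟨m, j⟩)
    {n : ℕ} {i : κ n} {m : ℕ} {j : κ m} {y : Fin m → ℝ} (hy : ‖y‖ < 1) :
    CellCollar ψ n i (ψ m j y) ↔ (⟨n, i⟩ : Σ n, κ n) = ⟨m, j⟩ ∨
      (n < m ∧ 1 / 2 < ‖y‖ ∧ CellCollar ψ n i (ψ m j (‖y‖⁻¹ • y))) := by
  have hyb : y ∈ Metric.ball (0 : Fin m → ℝ) 1 := mem_ball_zero_iff.2 hy
  constructor
  · intro h
    generalize hx : ψ m j y = x at h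
    cases h with
    | base z hz => exact .inl (hdisj n i m j z (mem_ball_zero_iff.2 hz) y hyb hx.symm)
    | step m' j' z hm hz hz' h =>
      have hzb : z ∈ Metric.ball (0 : Fin m' → ℝ) 1 := mem_ball_zero_iff.2 hz'
      obtain ⟨rfl, h2⟩ := Sigma.mk.inj_iff.1 (hdisj m' j' m j z hzb y hyb hx.symm)
      obtain rfl := eq_of_heq h2
      obtain rfl := hinj _ _ hyb hzb hx
      exact .inr ⟨hm, hz, h⟩
  · rintro (h | ⟨h1, h2, h3⟩)
    · obtain ⟨rfl, h2⟩ := Sigma.mk.inj_iff.1 h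
      obtain rfl := eq_of_heq h2
      exact .base y hy
    · exact .step m j y h1 h2 hy h3

lemma CellCollar.eq
    (hinj : ∀ n i, Set.InjOn (ψ n i) (Metric.ball 0 1))
    (hdisj : ∀ n i m j, ∀ y ∈ Metric.ball 0 1, ∀ z ∈ Metric.ball 0 1, ψ n i y = ψ m j z →
      (⟨n, i⟩ : Σ n, κ n) = ⟨m, j⟩)
    {n : ℕ} {i i' : κ n} {x : X} (h : CellCollar ψ n i x) (h' : CellCollar ψ n i' x) :
    i = i' := by
  induction h with
  | base y hy =>
    rcases (cellCollar_iff_of_mem hinj hdisj hy).1 h' with h | h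
    · exact (eq_of_heq (Sigma.mk.inj_iff.1 h).2).symm
    · exact absurd h.1 (lt_irrefl n)
  | step m j y hm hy hy' _ ih =>
    rcases (cellCollar_iff_of_mem hinj hdisj hy').1 h' with h | h
    · exact absurd (Sigma.mk.inj_iff.1 h).1 hm.ne
    · exact ih h.2.2

end Collar

/-- Collars do not meet the skeleton below the dimension of the cell. -/
lemma not_cellCollar_of_mem_closedCell [CWComplex (Set.univ : Set X)]
    {ψ : ∀ n : ℕ, cell (Set.univ : Set X) n → (Fin n → ℝ) → X}
    (hinj : ∀ n i, Set.InjOn (ψ n i) (Metric.ball 0 1))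
    (hdisj : ∀ n i m j, ∀ y ∈ Metric.ball 0 1, ∀ z ∈ Metric.ball 0 1, ψ n i y = ψ m j z →
      (⟨n, i⟩ : Σ n, cell (Set.univ : Set X) n) = ⟨m, j⟩)
    (hclosedCell : ∀ n i, ψ n i '' Metric.closedBall 0 1 =
      closedCell (C := (Set.univ : Set X)) n i)
    (hfrontier : ∀ n i, ∃ I : ∀ m, Set (cell (Set.univ : Set X) m),
      (∀ m, (I m).Finite) ∧ Set.MapsTo (ψ n i) (Metric.sphere 0 1) (⋃ (m < n) (j ∈ I m),
        closedCell (C := (Set.univ : Set X)) m j))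
    {n : ℕ} {i : cell (Set.univ : Set X) n} {m : ℕ} (hm : m < n)
    (j : cell (Set.univ : Set X) m) {x : X} (hx : x ∈ closedCell (C := (Set.univ : Set X)) m j) :
    ¬ CellCollar ψ n i x := by
  induction m using Nat.strong_induction_on generalizing x with
  | _ m ih =>
  rw [← hclosedCell] at hx
  obtain ⟨y, hy, rfl⟩ := hx
  rcases (mem_closedBall_zero_iff.1 hy).lt_or_eq with h | h
  · rw [cellCollar_iff_of_mem hinj hdisj h]
    rintro (h | h)
    · exact hm.ne' (Sigma.mk.inj_iff.1 h).1
    · exact hm.not_gt h.1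
  · obtain ⟨I, -, hmaps⟩ := hfrontier m j
    have hmem := hmaps (mem_sphere_zero_iff_norm.2 h)
    simp only [Set.mem_iUnion, exists_prop] at hmem
    obtain ⟨l, hl, k, -, hk⟩ := hmem
    exact ih l hl (hl.trans hm) k hk

/-- Collars are open: by the weak topology this may be checked on closed cells, where it follows by
induction on the dimension. -/
lemma isOpen_cellCollar [T2Space X] [CWComplex (Set.univ : Set X)]
    {ψ : ∀ n : ℕ, cell (Set.univ : Set X) n → (Fin n → ℝ) → X}
    (hcont : ∀ n i, ContinuousOn (ψ n i) (Metric.closedBall 0 1))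
    (hinj : ∀ n i, Set.InjOn (ψ n i) (Metric.ball 0 1))
    (hdisj : ∀ n i m j, ∀ y ∈ Metric.ball 0 1, ∀ z ∈ Metric.ball 0 1, ψ n i y = ψ m j z →
      (⟨n, i⟩ : Σ n, cell (Set.univ : Set X) n) = ⟨m, j⟩)
    (hclosedCell : ∀ n i, ψ n i '' Metric.closedBall 0 1 =
      closedCell (C := (Set.univ : Set X)) n i)
    (hfrontier : ∀ n i, ∃ I : ∀ m, Set (cell (Set.univ : Set X) m),
      (∀ m, (I m).Finite) ∧ Set.MapsTo (ψ n i) (Metric.sphere 0 1) (⋃ (m < n) (j ∈ I m),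
        closedCell (C := (Set.univ : Set X)) m j))
    (n : ℕ) (i : cell (Set.univ : Set X) n) : IsOpen {x | CellCollar ψ n i x} := by
  set A : Set X := {x | ¬ CellCollar ψ n i x} with hA
  suffices h : ∀ m j, IsClosed (A ∩ closedCell (C := (Set.univ : Set X)) m j) by
    have : IsClosed A := (CWComplex.closed (Set.univ : Set X) A (Set.subset_univ A)).2 h
    exact isClosed_compl_iff.1 this
  intro m
  induction m using Nat.strong_induction_on with
  | _ m ih =>
  intro j
  have hball : ∀ y : Fin m → ℝ, y ∈ Metric.closedBall 0 1 → y ∉ Metric.sphere 0 1 → ‖y‖ < 1 :=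
    fun y hy hy' => lt_of_le_of_ne (mem_closedBall_zero_iff.1 hy) fun h =>
      hy' (mem_sphere_zero_iff_norm.2 h)
  -- the points of the boundary sphere that are mapped outside of the collar
  have hsphere : IsClosed (Metric.sphere (0 : Fin m → ℝ) 1 ∩ ψ m j ⁻¹' A) := by
    obtain ⟨I, hI, hmaps⟩ := hfrontier m j
    have hcl : IsClosed (⋃ l ∈ Set.Iio m, ⋃ k ∈ I l,
        A ∩ closedCell (C := (Set.univ : Set X)) l k) :=
      (Set.finite_Iio m).isClosed_biUnion fun l hl =>
        (hI l).isClosed_biUnion fun k _ => ih l hl k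
    have := ((hcont m j).mono Metric.sphere_subset_closedBall).preimage_isClosed_of_isClosed
      Metric.isClosed_sphere hcl
    convert this using 1
    ext y
    refine and_congr_right fun hy => ⟨fun hyA => ?_, fun h => ?_⟩
    · have h1 := hmaps hy
      simp only [Set.mem_iUnion, exists_prop] at h1
      obtain ⟨l, hl, k, hk, h2⟩ := h1
      simp only [Set.mem_preimage, Set.mem_iUnion, exists_prop]
      exact ⟨l, hl, k, hk, hyA, h2⟩
    · simp only [Set.mem_preimage, Set.mem_iUnion, exists_prop] at h
      obtain ⟨l, hl, k, hk, h2, -⟩ := h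
      exact h2
  suffices hpre : IsClosed (Metric.closedBall (0 : Fin m → ℝ) 1 ∩ ψ m j ⁻¹' A) by
    have hcomp : IsCompact (Metric.closedBall (0 : Fin m → ℝ) 1 ∩ ψ m j ⁻¹' A) :=
      (isCompact_closedBall 0 1).of_isClosed_subset hpre Set.inter_subset_left
    have := (hcomp.image_of_continuousOn ((hcont m j).mono Set.inter_subset_left)).isClosed
    rwa [Set.image_inter_preimage, hclosedCell, Set.inter_comm] at this
  by_cases hij : (⟨n, i⟩ : Σ n, cell (Set.univ : Set X) n) = ⟨m, j⟩
  · -- all interior points belong to the collar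
    convert hsphere using 1
    ext y
    refine ⟨fun ⟨hy, hyA⟩ => ⟨by_contra fun hy' => hyA ?_, hyA⟩,
      fun ⟨hy, hyA⟩ => ⟨Metric.sphere_subset_closedBall hy, hyA⟩⟩
    exact (cellCollar_iff_of_mem hinj hdisj (hball y hy hy')).2 (.inl hij)
  rcases le_or_gt m n with hmn | hmn
  · -- no point of the closed cell belongs to the collar
    suffices hsub : Metric.closedBall (0 : Fin m → ℝ) 1 ⊆ ψ m j ⁻¹' A by
      rw [Set.inter_eq_left.2 hsub]
      exact Metric.isClosed_closedBall
    intro y hy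
    by_cases hy' : y ∈ Metric.sphere 0 1
    · obtain ⟨I, -, hmaps⟩ := hfrontier m j
      have hmem := hmaps hy'
      simp only [Set.mem_iUnion, exists_prop] at hmem
      obtain ⟨l, hl, k, -, hk⟩ := hmem
      exact not_cellCollar_of_mem_closedCell hinj hdisj hclosedCell hfrontier
        (hl.trans_le hmn) k hk
    · intro h
      rcases (cellCollar_iff_of_mem hinj hdisj (hball y hy hy')).1 h with h | h
      · exact hij h
      · exact hmn.not_gt h.1
  -- A point of the closed ball lies in the collar if and only if it lies in the outer part and its
  -- radial projection lies in the collar.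
  have hcontproj : ContinuousOn (fun y : Fin m → ℝ => ‖y‖⁻¹ • y) {y | 1 / 2 ≤ ‖y‖} := by
    refine (continuous_norm.continuousOn.inv₀ fun y hy => ?_).smul continuousOn_id
    have : (1 : ℝ) / 2 ≤ ‖y‖ := hy
    linarith
  have houter := hcontproj.preimage_isClosed_of_isClosed
    (isClosed_le continuous_const continuous_norm) hsphere
  have hinner : IsClosed {y : Fin m → ℝ | ‖y‖ ≤ 1 / 2} :=
    isClosed_le continuous_norm continuous_const
  convert (hinner.union houter).inter (Metric.isClosed_closedBall (x := (0 : Fin m → ℝ)) (ε := 1))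
    using 1
  ext y
  rw [Set.inter_comm]
  refine and_congr_left fun hy => ?_
  have hout : 1 / 2 < ‖y‖ → (y ∈ ψ m j ⁻¹' A ↔ ψ m j (‖y‖⁻¹ • y) ∈ A) := by
    intro h
    by_cases hy' : y ∈ Metric.sphere 0 1
    · rw [mem_sphere_zero_iff_norm.1 hy', inv_one, one_smul, Set.mem_preimage]
    · refine not_congr ((cellCollar_iff_of_mem hinj hdisj (hball y hy hy')).trans ?_)
      exact ⟨fun h' => (h'.resolve_left hij).2.2, fun h' => .inr ⟨hmn, h, h'⟩⟩
  constructor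
  · intro hyA
    rcases le_or_gt ‖y‖ (1 / 2) with h | h
    · exact .inl h
    · refine .inr ⟨h.le, mem_sphere_zero_iff_norm.2 ?_, (hout h).1 hyA⟩
      rw [norm_smul, norm_inv, norm_norm]
      exact inv_mul_cancel₀ (by linarith)
  · intro h
    rcases le_or_gt ‖y‖ (1 / 2) with h' | h'
    · intro hc
      have hy1 : ‖y‖ < 1 := by linarith
      rcases (cellCollar_iff_of_mem hinj hdisj hy1).1 hc with h'' | h''
      · exact hij h''
      · exact h''.2.1.not_ge h'
    · rcases h with h | h
      · exact absurd h (not_le.2 h')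
      · exact (hout h').2 h.2.2

theorem exists_isEqasdimCovering_of_isGCWAction [ContinuousConstSMul G X] [TopologicalSpace G]
    (S : Set G) (F : SubgroupFamily G) (hX : IsGCWAction F X) :
    ∃ U : Set (Set (G × X)), IsEqasdimCovering F S ⊤ U := by
  obtain ⟨_, _, ⟨N, hN⟩, hperm, hfix, hstab⟩ := hX
  obtain ⟨ψ, hcont, hinj, hopenCell, hclosedCell, hfrontier, hequiv⟩ :=
    exists_equivariant_characteristicMaps hperm hfix
  have hdisj : ∀ n i m j, ∀ y ∈ Metric.ball 0 1, ∀ z ∈ Metric.ball 0 1, ψ n i y = ψ m j z →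
      (⟨n, i⟩ : Σ n, cell (Set.univ : Set X) n) = ⟨m, j⟩ := by
    intro n i m j y hy z hz h
    by_contra hne
    have h1 : ψ n i y ∈ openCell (C := (Set.univ : Set X)) n i :=
      hopenCell n i ▸ Set.mem_image_of_mem _ hy
    have h2 : ψ m j z ∈ openCell (C := (Set.univ : Set X)) m j :=
      hopenCell m j ▸ Set.mem_image_of_mem _ hz
    exact Set.disjoint_left.1 (RelCWComplex.disjoint_openCell_of_ne hne) h1 (h ▸ h2)
  have hcollar : ∀ (g : G) n i i', g • openCell (C := (Set.univ : Set X)) n i =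
      openCell (C := (Set.univ : Set X)) n i' → ∀ x, CellCollar ψ n i x →
        CellCollar ψ n i' (g • x) := by
    intro g n i i' hg x hx
    induction hx with
    | base y hy =>
      rw [← hequiv g n i i' hg y (mem_closedBall_zero_iff.2 hy.le)]
      exact .base y hy
    | step m j y hm hy hy' _ ih =>
      obtain ⟨j', hj'⟩ := hperm g m j
      rw [← hequiv g m j j' hj' y (mem_closedBall_zero_iff.2 hy'.le)]
      refine .step m j' y hm hy hy' ?_
      rw [hequiv g m j j' hj' _ (mem_closedBall_zero_iff.2 ?_)]
      · exact ih
      · rw [norm_smul, norm_inv, norm_norm]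
        exact inv_mul_le_one
  have hsmul : ∀ (g : G) n i i', g • openCell (C := (Set.univ : Set X)) n i =
      openCell (C := (Set.univ : Set X)) n i' →
        g • {x | CellCollar ψ n i x} = {x | CellCollar ψ n i' x} := by
    intro g n i i' hg
    ext x
    rw [Set.mem_smul_set_iff_inv_smul_mem]
    refine ⟨fun h => ?_, fun h => hcollar g⁻¹ n i' i (by rw [← hg, inv_smul_smul]) x h⟩
    have := hcollar g n i i' hg _ h
    rwa [smul_inv_smul] at this
  have heq : ∀ n i i' x, CellCollar ψ n i x → CellCollar ψ n i' x → i = i' :=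
    fun n i i' x h h' => h.eq hinj hdisj h'
  refine exists_isEqasdimCovering_of_coloring S F
    (fun c : Σ n, cell (Set.univ : Set X) n => {x | CellCollar ψ c.1 c.2 x}) Sigma.fst
    (fun c => isOpen_cellCollar hcont hinj hdisj hclosedCell hfrontier c.1 c.2) (fun x => ?_) ?_
    (fun g c => ?_) (fun c hne => ?_) (n := N) (fun x => ?_)
  · have hx : x ∈ ⋃ (n) (i), openCell (C := (Set.univ : Set X)) n i := by
      rw [CWComplex.iUnion_openCell_eq_complex]
      trivial
    obtain ⟨n, i, hx⟩ := Set.mem_iUnion₂.1 hx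
    rw [← hopenCell] at hx
    obtain ⟨y, hy, rfl⟩ := hx
    exact ⟨⟨n, i⟩, .base y (mem_ball_zero_iff.1 hy)⟩
  · rintro ⟨n, i⟩ ⟨m, j⟩ (rfl : n = m) ⟨x, h1, h2⟩
    rw [heq n i j x h1 h2]
  · obtain ⟨j, hj⟩ := hperm g c.1 c.2
    exact ⟨⟨c.1, j⟩, rfl, hsmul g _ _ _ hj⟩
  · refine F.subgroup_mem _ (hstab c.1 c.2) _ fun g hg => ?_
    obtain ⟨j, hj⟩ := hperm g c.1 c.2
    rw [MulAction.mem_stabilizer_iff, hsmul g _ _ _ hj] at hg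
    obtain ⟨x, hx⟩ := hne
    have : c.2 = j := heq c.1 c.2 j x hx (hg.symm ▸ hx : x ∈ {x | CellCollar ψ c.1 j x})
    exact hj.trans (by rw [← this])
  · have hsub : {k | ∃ c : Σ n, cell (Set.univ : Set X) n, c.1 = k ∧
        x ∈ {x | CellCollar ψ c.1 c.2 x}} ⊆ (Finset.range (N + 1) : Set ℕ) := by
      rintro _ ⟨c, rfl, -⟩
      by_contra h
      exact (hN c.1 (by simpa using h)).false c.2
    refine (Set.encard_le_encard hsub).trans ?_
    rw [Set.encard_coe_eq_coe_finsetCard]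
    simp

end CW

end EqAsdim

theorem mainTheorem6 {G : Type u} [Group G] [TopologicalSpace G] [DiscreteTopology G]
    (S : Finset G) (hS : Subgroup.closure (S : Set G) = ⊤) (F : EqAsdim.SubgroupFamily G)
    {X : Type w} [TopologicalSpace X] [MulAction G X] [ContinuousConstSMul G X]
    (hX : EqAsdim.IsSimplicialAction.{v} F X ∨ EqAsdim.IsGCWAction F X ∨
      (T3Space X ∧ EqAsdim.IsProperAction G X ∧
        (∀ x : X, MulAction.stabilizer G x ∈ F.carrier) ∧
        (EqAsdim.IsCocompactAction G X ∨
          ((∃ n : ℕ, EqAsdim.CoveringDimLE X n) ∧ EqAsdim.AdmitsInvariantMetric G X)))) :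
    ∃ U : Set (Set (G × X)), EqAsdim.IsEqasdimCovering F (S : Set G) ⊤ U := by
  rcases hX with hX | hX | ⟨_, hP, hF, hX⟩
  · exact EqAsdim.exists_isEqasdimCovering_of_isSimplicialAction (S : Set G) F hX
  · exact EqAsdim.exists_isEqasdimCovering_of_isGCWAction (S : Set G) F hX
  rcases hX with hX | ⟨⟨n, hn⟩, m, rfl, hm⟩
  · exact EqAsdim.exists_isEqasdimCovering_of_isCocompactAction (S : Set G) F hF hP hX
  · have : IsIsometricSMul G X := ⟨fun g => Isometry.of_dist_eq (hm g)⟩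
    exact EqAsdim.exists_isEqasdimCovering_of_coveringDimLE (S : Set G) F hF hP hn
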